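/- **Setting.** Let $\mathcal G=(V,E)$ be a finite connected simple undirected graph with $n=|V|$, let $S_0,S_1\subset V$ be disjoint nonempty sets ($0$-leaders and $1$-leaders), and let $F=V\setminus(S_0\cup S_1)$ be the set of followers, $N=|F|\ge 2$. In the DeGroot model the opinions of nodes in $S_0$ and $S_1$ are constantly $0$ and $1$, and each follower starts from an arbitrary opinion in $[0,1]$ and at each step replaces its opinion by the average of its neighbours' current opinions; $x(\infty)$ is the limit of the opinions and $H(\mathcal G)=\sum_{i\in F}x_i(\infty)$. For a non-edge $e$ between a follower and a $1$-leader put $\Delta(e)=H(\mathcal G+e)-H(\mathcal G)$. Let $0<\epsilon<1/2$, $1/2<\eta<1$, and let $Q$ be a set of candidate edges: pairs $e=(i,u)\notin E$ with $i\in F$, $u\in S_1$ and $x_i(\infty)\le\eta$. Let $L_F$ be the $F\times F$ block of the Laplacian of $\mathcal G$, $\bar B$ a signed edge-node incidence matrix (for any orientation) of the subgraph induced on $F$, $W$ the diagonal matrix whose $i$-th entry is the number of neighbours of $i\in F$ in $S_0\cup S_1$, $b_i$ the number of neighbours of $i$ in $S_1$, and $\mathbf 1$ the all-ones vector. Write $\|x\|_S=\sqrt{x^\top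 S x}$. **Solver.** Let $\textsc{Solve}$ be a randomized linear solver with failure probability at most $p$ per call: for each positive definite symmetric diagonally dominant real $F\times F$ matrix $S$, each $y\in\mathbb R^F$ and each $\delta>0$, it returns with probability at least $1-p$ a vector $x$ with $\|x-S^{-1}y\|_S\le\delta\|S^{-1}y\|_S$. Its output law is discrete, and different calls use independent randomness. **Algorithm $\textsc{OpinionComp}(\mathcal G,Q,\epsilon,\eta)$.** Set $$\delta_1=\frac{\epsilon}{2n^2\sqrt{6(n^2-1)}},\quad \delta_2=\frac{(1-\eta)\epsilon}{n^2\sqrt{6(n^2-1)}},\quad \delta_3=\frac{\epsilon}{72n^2}\sqrt{\frac{6(1-\epsilon/12)}{(1+\epsilon/12)(n^2-1)}},\quad t=\Big\lceil\frac{24\log N}{(\epsilon/12)^2}\Big\rceil .$$ Draw random matrices $P$ (with $t$ rows, and columns indexed by the edges of the subgraph induced on $F$) and $R$ (with $t$ rows, and columns indexed by $F$), all entries independent and equal to $\pm1/\sqrt t$ with probability $1/2$ each. Compute $h=\textsc{Solve}(L_F,\mathbf 1,\delta_1)$, $q=\textsc{Solve}(L_F,b,\delta_2)$ and, for $1\le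 i\le t$, the rows $\tilde X_{[i,:]}=\textsc{Solve}(L_F,(P\bar B)_{[i,:]},\delta_3)$ and $\tilde Y_{[i,:]}=\textsc{Solve}(L_F,(RW^{1/2})_{[i,:]},\delta_3)$. For each $e\in Q$, with $j$ the follower incident to $e$, return $$\tilde\Delta(e)=\frac{h_j(1-q_j)}{1+\|\tilde X e_j\|^2+\|\tilde Y e_j\|^2},$$ where $e_j$ is the $j$-th standard basis vector. **Theorem.** With high probability, namely with probability at least $$1-\frac1{N}-(2t+2)\,p,$$ the values returned by $\textsc{OpinionComp}$ satisfy, simultaneously for all $e\in Q$, $$(1-\epsilon)\Delta(e)\le\tilde\Delta(e)\le(1+\epsilon)\Delta(e).$$ -/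

import Mathlib

open scoped Matrix BigOperators

noncomputable section

namespace OpinionDynamics

universe u

variable {V : Type u} [Fintype V] [DecidableEq V]

/-! ### The leader-follower DeGroot model -/

/-- The followers: the nodes that are neither 0-leaders nor 1-leaders. -/
abbrev Follower (S0 S1 : Finset V) : Type u := {v : V // v ∉ S0 ∪ S1}

open scoped Classical in
/-- Opinions at time `t`: a node of `S0` always holds opinion 0, a node of `S1` always holds
opinion 1, and a follower starts from `x0` and then repeatedly takes the average of the current
opinions of its neighbours. -/
def opinion (G : SimpleGraph V) (S0 S1 : Finset V) (x0 : Follower S0 S1 → ℝ) : ℕ → V → ℝ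
  | 0, i => if h : i ∈ S0 ∪ S1 then (if i ∈ S1 then 1 else 0) else x0 ⟨i, h⟩
  | t + 1, i =>
      if i ∈ S0 ∪ S1 then (if i ∈ S1 then 1 else 0)
      else (∑ j ∈ G.neighborFinset i, opinion G S0 S1 x0 t j) / (G.degree i : ℝ)

/-- The equilibrium opinions `x(∞) = lim x(t)`. -/
def equilibrium (G : SimpleGraph V) (S0 S1 : Finset V) (x0 : Follower S0 S1 → ℝ) : V → ℝ :=
  Filter.limUnder Filter.atTop (opinion G S0 S1 x0)

/-- The overall equilibrium opinion `H(G)` of the followers. -/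
def overallOpinion (G : SimpleGraph V) (S0 S1 : Finset V) (x0 : Follower S0 S1 → ℝ) : ℝ :=
  ∑ i : Follower S0 S1, equilibrium G S0 S1 x0 i

/-- `Δ(e) = H({e}) - H(∅)`: the increase of the overall opinion when the edge `e`, given by a
follower and a leader, is added to `G`. -/
def opinionGain (G : SimpleGraph V) (S0 S1 : Finset V) (x0 : Follower S0 S1 → ℝ)
    (e : Follower S0 S1 × V) : ℝ :=
  overallOpinion (G ⊔ SimpleGraph.edge (e.1 : V) e.2) S0 S1 x0 - overallOpinion G S0 S1 x0

/-- `Q` is a set of candidate edges with threshold `η`: each member joins a follower, whose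
equilibrium opinion is at most `η`, to a 1-leader, and is not an edge of `G`. -/
def IsCandidateSet (G : SimpleGraph V) (S0 S1 : Finset V) (x0 : Follower S0 S1 → ℝ) (η : ℝ)
    (Q : Finset (Follower S0 S1 × V)) : Prop :=
  ∀ e ∈ Q, e.2 ∈ S1 ∧ ¬ G.Adj (e.1 : V) e.2 ∧ equilibrium G S0 S1 x0 e.1 ≤ η

/-! ### Matrices -/

open scoped Classical in
/-- The block `L_F` of the Laplacian of `G` indexed by the followers. -/
def followerLaplacian (G : SimpleGraph V) (S0 S1 : Finset V) :
    Matrix (Follower S0 S1) (Follower S0 S1) ℝ :=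
  (G.lapMatrix ℝ).submatrix Subtype.val Subtype.val

open scoped Classical in
/-- The vector `b`: the number of edges between a follower and the 1-leaders. -/
def oneLeaderCount (G : SimpleGraph V) (S0 S1 : Finset V) : Follower S0 S1 → ℝ :=
  fun i => ((S1.filter fun v => G.Adj (i : V) v).card : ℝ)

open scoped Classical in
/-- The diagonal of `W`: the number of edges between a follower and all leaders. -/
def leaderCount (G : SimpleGraph V) (S0 S1 : Finset V) : Follower S0 S1 → ℝ :=
  fun i => (((S0 ∪ S1).filter fun v => G.Adj (i : V) v).card : ℝ)

/-- `W^{1/2}`. -/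
def sqrtLeaderMatrix (G : SimpleGraph V) (S0 S1 : Finset V) :
    Matrix (Follower S0 S1) (Follower S0 S1) ℝ :=
  Matrix.diagonal fun i => Real.sqrt (leaderCount G S0 S1 i)

/-- The subgraph of `G` induced on the followers. -/
abbrev followerGraph (G : SimpleGraph V) (S0 S1 : Finset V) : SimpleGraph (Follower S0 S1) :=
  G.comap Subtype.val

/-- An orientation of all edges of a graph. -/
structure EdgeOrientation {α : Type u} (H : SimpleGraph α) where
  head : H.edgeSet → α
  tail : H.edgeSet → α
  ends : ∀ e : H.edgeSet, (e : Sym2 α) = s(head e, tail e)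

/-- The signed edge-node incidence matrix of an oriented graph. -/
def incidence {α : Type u} [DecidableEq α] {H : SimpleGraph α} (o : EdgeOrientation H) :
    Matrix H.edgeSet α ℝ :=
  Matrix.of fun e v => if v = o.head e then 1 else if v = o.tail e then -1 else 0

/-! ### Randomized computation -/

/-- The probability of the event `E` under the law `μ`. -/
def prob {α : Type u} (μ : PMF α) (E : Set α) : ℝ := (μ.toOuterMeasure E).toReal

/-- The results of `t` successive independent random draws, the `i`-th one with law `μ i`. -/
def drawAll {α : Type u} : (t : ℕ) → (Fin t → PMF α) → PMF (Fin t → α)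
  | 0, _ => PMF.pure Fin.elim0
  | t + 1, μ => (μ 0).bind fun a =>
      (drawAll t fun i => μ i.succ).map fun r => (Fin.cons a r : Fin (t + 1) → α)

/-- The `±1/√t` matrix with the given signs. -/
def signMatrix {t : ℕ} {ι : Type u} (σ : Fin t → ι → Bool) : Matrix (Fin t) ι ℝ :=
  Matrix.of fun i j => if σ i j then 1 / Real.sqrt t else -(1 / Real.sqrt t)

/-- The law of a random `t × ι` matrix with independent entries, each of them `1/√t` or `-1/√t`
with probability `1/2`. -/
def randomSignMatrix (t : ℕ) (ι : Type u) [Fintype ι] [DecidableEq ι] :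
    PMF (Matrix (Fin t) ι ℝ) :=
  (PMF.uniformOfFintype (Fin t → ι → Bool)).map signMatrix

/-- The energy norm `‖x‖_S = √(xᵀ S x)`. -/
def energyNorm {ι : Type u} [Fintype ι] (S : Matrix ι ι ℝ) (x : ι → ℝ) : ℝ :=
  Real.sqrt (x ⬝ᵥ (S *ᵥ x))

/-- Symmetric diagonally dominant matrices. -/
def IsSDD {ι : Type u} [Fintype ι] [DecidableEq ι] (S : Matrix ι ι ℝ) : Prop :=
  S.IsSymm ∧ ∀ i, ∑ j ∈ Finset.univ.erase i, |S i j| ≤ S i i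

/-- A randomized linear solver takes a matrix, a right-hand side and an error parameter, and
returns a random vector (its randomness comes from random bits, so the law is discrete). -/
abbrev Solver (ι : Type u) : Type u := Matrix ι ι ℝ → (ι → ℝ) → ℝ → PMF (ι → ℝ)

/-- `Solve` is an SDD solver with failure probability at most `p`: on every invertible (positive
definite) SDD system `S x = y` and for every `δ > 0`, it returns, with probability at least
`1 - p`, an `x` with `‖x - S⁻¹ y‖_S ≤ δ ‖S⁻¹ y‖_S`. -/
def IsSDDSolver {ι : Type u} [Fintype ι] [DecidableEq ι] (Solve : Solver ι) (p : ℝ) : Prop :=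
  ∀ (S : Matrix ι ι ℝ) (y : ι → ℝ) (δ : ℝ), IsSDD S → S.PosDef → 0 < δ →
    1 - p ≤ prob (Solve S y δ)
      {x | energyNorm S (x - S⁻¹ *ᵥ y) ≤ δ * energyNorm S (S⁻¹ *ᵥ y)}

/-! ### The algorithm -/

/-- The number `t` of rows of the random projections, for `N` followers. -/
def numRows (N : ℕ) (ε : ℝ) : ℕ := ⌈24 * Real.log N / (ε / 12) ^ 2⌉₊

def delta1 (n : ℕ) (ε : ℝ) : ℝ := ε / (2 * (n : ℝ) ^ 2 * Real.sqrt (6 * ((n : ℝ) ^ 2 - 1)))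

def delta2 (n : ℕ) (ε η : ℝ) : ℝ :=
  (1 - η) * ε / ((n : ℝ) ^ 2 * Real.sqrt (6 * ((n : ℝ) ^ 2 - 1)))

def delta3 (n : ℕ) (ε : ℝ) : ℝ :=
  ε / (72 * (n : ℝ) ^ 2) *
    Real.sqrt (6 * (1 - ε / 12) / ((1 + ε / 12) * ((n : ℝ) ^ 2 - 1)))

open scoped Classical in
/-- The randomized algorithm `OpinionComp`, with `Solve` as its linear solver and `o` as the
orientation that defines the incidence matrix: the law of the returned values `Δ̃(e)`, `e ∈ Q`.
Each call of `Solve` uses fresh randomness. -/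
def opinionComp (G : SimpleGraph V) (S0 S1 : Finset V)
    (o : EdgeOrientation (followerGraph G S0 S1)) (Solve : Solver (Follower S0 S1))
    (Q : Finset (Follower S0 S1 × V)) (ε η : ℝ) : PMF (Q → ℝ) :=
  let n := Fintype.card V
  let t := numRows (Fintype.card (Follower S0 S1)) ε
  let L := followerLaplacian G S0 S1
  do
    let P ← randomSignMatrix t (followerGraph G S0 S1).edgeSet
    let R ← randomSignMatrix t (Follower S0 S1)
    let Xbar := P * incidence o
    let Ybar := R * sqrtLeaderMatrix G S0 S1
    let h ← Solve L (fun _ => 1) (delta1 n ε)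
    let p ← Solve L (oneLeaderCount G S0 S1) (delta2 n ε η)
    let X ← drawAll t fun i => Solve L (Xbar i) (delta3 n ε)
    let Y ← drawAll t fun i => Solve L (Ybar i) (delta3 n ε)
    return fun e =>
      let j := (e : Follower S0 S1 × V).1
      h j * (1 - p j) / (1 + ∑ i, X i j ^ 2 + ∑ i, Y i j ^ 2)

end OpinionDynamics

end

open OpinionDynamics

namespace OpinionDynamics

open scoped ENNReal

/-! ### Failure probabilities -/

/-! Write L for the follower Laplacian, g for column j of its inverse, r = g_j, h = L⁻¹1 and x =
L⁻¹b. The equilibrium opinions of the followers are x. A new edge from j to a 1-leader adds 1 to the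
diagonal entry L_jj and to b_j, so the opinions change by (1 - x_j)/(1 + r) · g. Summing over the
followers and using the symmetry of L gives Δ(e) = h_j(1 - x_j)/(1 + r), see `opinionGain_eq`. The
algorithm approximates each of the three ingredients.

As a quadratic form L is BᵀB + W, hence r = gᵀLg = ‖Bg‖² + ‖W^{1/2}g‖². Random sign projections with
t rows preserve both squared lengths up to 1 ± ε/12 for all N columns, except with probability
1/(2N) for each matrix (`isGoodProjection_failure_le`).

A solver error is small in energy norm. Cauchy–Schwarz, v_j² ≤ r · vᵀLv (`sq_apply_le_mul_energy`),
makes it an entrywise error. Together with bounds on the energies of the exact solutions and 1/n ≤ r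
≤ n, the relative errors are ε/18 for h_j, ε/9 for 1 - x_j and ε/6 for r; `quotient_accuracy`
combines them. A union bound over two projections and 2t + 2 solver calls finishes the proof. -/

theorem toOuterMeasure_add_compl {α : Type*} (μ : PMF α) (E : Set α) :
    μ.toOuterMeasure E + μ.toOuterMeasure Eᶜ = 1 := by
  rw [PMF.toOuterMeasure_apply, PMF.toOuterMeasure_apply, ← ENNReal.tsum_add, ← μ.tsum_coe]
  refine tsum_congr fun x => ?_
  by_cases hx : x ∈ E <;> simp [hx]

theorem toOuterMeasure_le_one {α : Type*} (μ : PMF α) (E : Set α) :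
    μ.toOuterMeasure E ≤ 1 :=
  (toOuterMeasure_add_compl μ E) ▸ le_self_add

theorem prob_eq_one_sub {α : Type*} (μ : PMF α) (E : Set α) :
    prob μ E = 1 - (μ.toOuterMeasure Eᶜ).toReal := by
  have h := congrArg ENNReal.toReal (toOuterMeasure_add_compl μ E)
  rw [ENNReal.toReal_add (ne_top_of_le_ne_top ENNReal.one_ne_top (toOuterMeasure_le_one μ _))
    (ne_top_of_le_ne_top ENNReal.one_ne_top (toOuterMeasure_le_one μ _))] at h
  simp only [ENNReal.toReal_one] at h
  unfold prob
  linarith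

theorem toOuterMeasure_compl_le_of_le_prob {α : Type*} {μ : PMF α} {E : Set α} {p : ℝ}
    (h : 1 - p ≤ prob μ E) : μ.toOuterMeasure Eᶜ ≤ ENNReal.ofReal p := by
  rw [prob_eq_one_sub] at h
  rw [← ENNReal.ofReal_toReal
    (ne_top_of_le_ne_top ENNReal.one_ne_top (toOuterMeasure_le_one μ Eᶜ))]
  exact ENNReal.ofReal_le_ofReal (by linarith)

theorem nonneg_of_le_prob {α : Type*} {μ : PMF α} {E : Set α} {p : ℝ}
    (h : 1 - p ≤ prob μ E) : 0 ≤ p := by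
  rw [prob_eq_one_sub] at h
  linarith [ENNReal.toReal_nonneg (a := μ.toOuterMeasure Eᶜ)]

theorem le_prob_of_toOuterMeasure_compl_le {α : Type*} {μ : PMF α} {E : Set α} {c : ℝ}
    (hc : 0 ≤ c) (h : μ.toOuterMeasure Eᶜ ≤ ENNReal.ofReal c) : 1 - c ≤ prob μ E := by
  rw [prob_eq_one_sub]
  linarith [ENNReal.toReal_le_of_le_ofReal hc h]

/-- Union bound for a two-stage draw: either the first draw leaves `A`, or it is good and the second
stage fails. The main theorem uses it once per `bind` of the algorithm. -/
theorem toOuterMeasure_bind_compl_le {α β : Type*} (μ : PMF α) (f : α → PMF β) (A : Set α)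
    (E : Set β) {a b : ℝ≥0∞} (ha : μ.toOuterMeasure Aᶜ ≤ a)
    (hb : ∀ x ∈ A, (f x).toOuterMeasure Eᶜ ≤ b) :
    (μ.bind f).toOuterMeasure Eᶜ ≤ a + b := by
  calc (μ.bind f).toOuterMeasure Eᶜ = ∑' x, μ x * (f x).toOuterMeasure Eᶜ :=
        PMF.toOuterMeasure_bind_apply _ _ _
    _ ≤ ∑' x, (Aᶜ.indicator μ x + μ x * b) := by
        refine ENNReal.tsum_le_tsum fun x => ?_
        by_cases hx : x ∈ A
        · exact (mul_le_mul_right (hb x hx) _).trans le_add_self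
        · rw [Set.indicator_of_mem (show x ∈ Aᶜ from hx)]
          exact (mul_le_of_le_one_right' (toOuterMeasure_le_one _ _)).trans le_self_add
    _ = μ.toOuterMeasure Aᶜ + b := by
        rw [ENNReal.tsum_add, ENNReal.tsum_mul_right, μ.tsum_coe, one_mul,
          PMF.toOuterMeasure_apply]
    _ ≤ a + b := by gcongr

theorem toOuterMeasure_drawAll_compl_le {α : Type*} {c : ℝ≥0∞} (t : ℕ) (μ : Fin t → PMF α)
    (A : Fin t → Set α) (h : ∀ i, (μ i).toOuterMeasure (A i)ᶜ ≤ c) :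
    (drawAll t μ).toOuterMeasure {r | ∀ i, r i ∈ A i}ᶜ ≤ t * c := by
  induction t with
  | zero => simp [drawAll]
  | succ t ih =>
    rw [drawAll, Nat.cast_succ, add_mul, one_mul, add_comm _ c]
    refine toOuterMeasure_bind_compl_le _ _ (A 0) _ (h 0) fun a ha => ?_
    rw [PMF.toOuterMeasure_map_apply]
    refine le_trans (MeasureTheory.measure_mono ?_)
      (ih (fun i => μ i.succ) (fun i => A i.succ) fun i => h i.succ)
    intro r hr hr'
    refine hr fun i => ?_
    refine Fin.cases ?_ (fun i => ?_) i
    · simpa using ha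
    · simpa using hr' i

/-! ### Random signs -/

section Signs

variable {ι : Type*} [Fintype ι] [DecidableEq ι]

/-- The signed sum `∑ ±u j`. -/
def signedSum (σ : ι → Bool) (u : ι → ℝ) : ℝ := ∑ j, if σ j then u j else -u j

/-- Sub-Gaussian moment bound. Expectations over signs are written as plain sums, hence the factor
2^|ι|. The sum factors over coordinates, and cosh y ≤ exp(y²/2) bounds each factor. -/
theorem sum_exp_signedSum_le (u : ι → ℝ) (l : ℝ) :
    ∑ σ : ι → Bool, Real.exp (l * signedSum σ u) ≤
      2 ^ Fintype.card ι * Real.exp (l ^ 2 / 2 * ∑ j, u j ^ 2) := by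
  have h1 : ∀ σ : ι → Bool, Real.exp (l * signedSum σ u) =
      ∏ j, Real.exp (if σ j then l * u j else -(l * u j)) := by
    intro σ
    rw [← Real.exp_sum, signedSum, Finset.mul_sum]
    congr 1
    refine Finset.sum_congr rfl fun j _ => ?_
    split_ifs <;> ring
  simp_rw [h1]
  rw [← Fintype.prod_sum fun j (b : Bool) => Real.exp (if b then l * u j else -(l * u j))]
  rw [Finset.mul_sum, Real.exp_sum, ← Finset.card_univ, ← Finset.prod_const,
    ← Finset.prod_mul_distrib]
  refine Finset.prod_le_prod (fun j _ => Finset.sum_nonneg fun b _ => (Real.exp_pos _).le)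
    fun j _ => ?_
  have := Real.cosh_le_exp_half_sq (l * u j)
  rw [Real.cosh_eq] at this
  simp only [Fintype.sum_bool, if_true, Bool.false_eq_true, if_false]
  rw [show l ^ 2 / 2 * u j ^ 2 = (l * u j) ^ 2 / 2 by ring]
  linarith

theorem integral_exp_linear_sub_sq {a : ℝ} (ha : 0 < a) (y : ℝ) :
    MeasureTheory.Integrable (fun l : ℝ => Real.exp (l * y - a * l ^ 2)) ∧
    ∫ l : ℝ, Real.exp (l * y - a * l ^ 2) =
      √(Real.pi / a) * Real.exp (y ^ 2 / (4 * a)) := by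
  have h : (fun l : ℝ => Real.exp (l * y - a * l ^ 2)) = fun l =>
      Real.exp (-a * (l - y / (2 * a)) ^ 2) * Real.exp (y ^ 2 / (4 * a)) := by
    funext l
    rw [← Real.exp_add]
    congr 1
    field_simp
    ring
  rw [h]
  refine ⟨((integrable_exp_neg_mul_sq ha).comp_sub_right (y / (2 * a))).mul_const _, ?_⟩
  rw [MeasureTheory.integral_mul_const,
    MeasureTheory.integral_sub_right_eq_self (fun l => Real.exp (-a * l ^ 2)),
    integral_gaussian]

/-- With Y the signed sum, exp(sY²) is, up to a constant, the Gaussian integral of exp(lY - al²)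
over l with a = 1/(4s). This linearises the square, so the sub-Gaussian bound applies under the
integral; the remaining integral converges because a > 1/2, that is, s < 1/2. -/
theorem sum_exp_mul_signedSum_sq_le {u : ι → ℝ} (hu : ∑ j, u j ^ 2 = 1) {s : ℝ}
    (hs : 0 < s) (hs' : s < 1 / 2) :
    ∑ σ : ι → Bool, Real.exp (s * signedSum σ u ^ 2) ≤
      2 ^ Fintype.card ι * √(1 / (1 - 2 * s)) := by
  set a : ℝ := 1 / (4 * s) with ha
  have ha0 : 0 < a := by positivity
  have ha1 : 0 < a - 1 / 2 := by
    rw [ha, sub_pos, div_lt_div_iff₀ (by norm_num) (by positivity)]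
    linarith
  have hint : ∫ l : ℝ, ∑ σ : ι → Bool, Real.exp (l * signedSum σ u - a * l ^ 2) =
      √(Real.pi / a) * ∑ σ : ι → Bool, Real.exp (s * signedSum σ u ^ 2) := by
    rw [MeasureTheory.integral_finsetSum _
      fun σ _ => (integral_exp_linear_sub_sq ha0 (signedSum σ u)).1, Finset.mul_sum]
    refine Finset.sum_congr rfl fun σ _ => ?_
    rw [(integral_exp_linear_sub_sq ha0 (signedSum σ u)).2]
    congr 2
    rw [ha]
    field_simp
  have hle : ∫ l : ℝ, ∑ σ : ι → Bool, Real.exp (l * signedSum σ u - a * l ^ 2) ≤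
      ∫ l : ℝ, 2 ^ Fintype.card ι * Real.exp (-(a - 1 / 2) * l ^ 2) := by
    refine MeasureTheory.integral_mono
      (MeasureTheory.integrable_finsetSum _
        fun σ _ => (integral_exp_linear_sub_sq ha0 (signedSum σ u)).1)
      ((integrable_exp_neg_mul_sq ha1).const_mul _) fun l => ?_
    simp only [Real.exp_sub, ← Finset.sum_div]
    rw [div_le_iff₀ (Real.exp_pos _), mul_assoc, ← Real.exp_add]
    refine (sum_exp_signedSum_le u l).trans_eq ?_
    rw [hu]
    congr 2
    ring
  rw [hint, MeasureTheory.integral_const_mul, integral_gaussian] at hle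
  have hpi : 0 < √(Real.pi / a) := Real.sqrt_pos.2 (by positivity)
  refine le_of_mul_le_mul_left (hle.trans_eq ?_) hpi
  rw [mul_left_comm, ← Real.sqrt_mul (by positivity)]
  congr 2
  rw [ha] at ha1 ⊢
  have : 1 - 2 * s ≠ 0 := by linarith
  have h2 : 1 / (4 * s) - 1 / 2 = (1 - 2 * s) / (4 * s) := by field_simp; ring
  rw [h2]
  field_simp

theorem sqrt_one_div_le_exp {s : ℝ} (hs : 0 ≤ s) (hs' : s ≤ 1 / 10) :
    √(1 / (1 - 2 * s)) ≤ Real.exp (s + 3 / 2 * s ^ 2) := by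
  have h1 : 0 < 1 - 2 * s := by linarith
  rw [Real.sqrt_le_left (Real.exp_pos _).le, ← Real.exp_nat_mul, div_le_iff₀ h1]
  have h := Real.quadratic_le_exp_of_nonneg (x := 2 * s + 3 * s ^ 2) (by positivity)
  have e : ((2 : ℕ) : ℝ) * (s + 3 / 2 * s ^ 2) = 2 * s + 3 * s ^ 2 := by push_cast; ring
  rw [e]
  refine le_trans ?_ (mul_le_mul_of_nonneg_right h h1.le)
  -- This is (1 + y + y²/2)(1 - 2s) - 1 for y = 2s + 3s².
  have h3 : 0 ≤ s ^ 2 * (1 - 4 * s - 15 / 2 * s ^ 2 - 9 * s ^ 3) := by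
    refine mul_nonneg (sq_nonneg s) ?_
    have h4 : s ^ 2 ≤ s * (1 / 10) := by rw [sq]; gcongr
    have h5 : s ^ 3 ≤ s ^ 2 * (1 / 10) := by rw [pow_succ]; gcongr
    linarith
  nlinarith [h3]

/-- Flipping the sign at `a`. -/
def flipAt {ι : Type*} [DecidableEq ι] (a : ι) : Equiv.Perm (ι → Bool) :=
  Function.Involutive.toPerm (fun σ => Function.update σ a (!σ a)) fun σ => by simp

theorem flipAt_apply {ι : Type*} [DecidableEq ι] (a : ι) (σ : ι → Bool) : flipAt a σ = Function.update σ a (!σ a) := rfl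

/-- Induction on the support. Pairing each sign vector with its flip at the new coordinate cancels
all odd powers of u_a. The fourth moment then closes because 3S² + 6u_a²S + u_a⁴ ≤ 3(S + u_a²)²,
where S is the old sum of squares. -/
theorem sum_signs_moments (u : ι → ℝ) (s : Finset ι) :
    ∑ σ : ι → Bool, (∑ j ∈ s, if σ j then u j else -u j) ^ 2 =
        2 ^ Fintype.card ι * ∑ j ∈ s, u j ^ 2 ∧
    ∑ σ : ι → Bool, (∑ j ∈ s, if σ j then u j else -u j) ^ 4 ≤
        2 ^ Fintype.card ι * (3 * (∑ j ∈ s, u j ^ 2) ^ 2) := by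
  induction s using Finset.induction_on with
  | empty => simp
  | insert a s ha ih =>
    set f : (ι → Bool) → ℝ := fun σ => ∑ j ∈ s, if σ j then u j else -u j with hf
    have hflip : ∀ σ, f (flipAt a σ) = f σ := by
      intro σ
      refine Finset.sum_congr rfl fun j hj => ?_
      have : j ≠ a := fun h => ha (h ▸ hj)
      rw [flipAt_apply, Function.update_of_ne this]
    have key : ∀ k : ℕ, ∑ σ : ι → Bool, ((if σ a then u a else -u a) + f σ) ^ k =
        ∑ σ : ι → Bool, ((f σ + u a) ^ k + (f σ - u a) ^ k) / 2 := by
      intro k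
      have h1 := Equiv.sum_comp (flipAt a)
        fun σ : ι → Bool => ((if σ a then u a else -u a) + f σ) ^ k
      have h2 : ∑ σ : ι → Bool, ((f σ + u a) ^ k + (f σ - u a) ^ k) =
          ∑ σ : ι → Bool, ((if σ a then u a else -u a) + f σ) ^ k +
          ∑ σ : ι → Bool, ((if flipAt a σ a then u a else -u a) + f (flipAt a σ)) ^ k := by
        rw [← Finset.sum_add_distrib]
        refine Finset.sum_congr rfl fun σ _ => ?_
        rw [hflip]
        have : flipAt a σ a = !σ a := by
          rw [flipAt_apply, Function.update_self]
        rw [this]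
        rcases σ a <;> simp <;> ring
      rw [← Finset.sum_div, h2, h1]
      ring
    have hc : ∑ _σ : ι → Bool, (1 : ℝ) = 2 ^ Fintype.card ι := by simp
    simp only [Finset.sum_insert ha]
    constructor
    · rw [key, mul_add, ← ih.1, ← hc, Finset.sum_mul, ← Finset.sum_add_distrib]
      exact Finset.sum_congr rfl fun σ _ => by ring
    · rw [key]
      have : ∑ σ : ι → Bool, ((f σ + u a) ^ 4 + (f σ - u a) ^ 4) / 2 =
          ∑ σ, f σ ^ 4 + 6 * u a ^ 2 * ∑ σ, f σ ^ 2 + u a ^ 4 * ∑ _σ : ι → Bool, (1 : ℝ) := by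
        rw [Finset.mul_sum, Finset.mul_sum, ← Finset.sum_add_distrib, ← Finset.sum_add_distrib]
        exact Finset.sum_congr rfl fun σ _ => by ring
      rw [this, ih.1, hc]
      have h4 : 0 ≤ (2 : ℝ) ^ Fintype.card ι * u a ^ 4 := by positivity
      nlinarith [ih.2, h4]

/-- For the lower tail it is enough to expand exp(-x) to second order, since the second moment is
exactly 1 and the fourth at most 3. -/
theorem sum_exp_neg_mul_signedSum_sq_le {u : ι → ℝ} (hu : ∑ j, u j ^ 2 = 1) {s : ℝ}
    (hs : 0 ≤ s) :
    ∑ σ : ι → Bool, Real.exp (-(s * signedSum σ u ^ 2)) ≤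
      2 ^ Fintype.card ι * Real.exp (-s + 3 / 2 * s ^ 2) := by
  obtain ⟨h2, h4⟩ := sum_signs_moments u Finset.univ
  rw [hu] at h2 h4
  -- Since (1 + x + x²/2)(1 - x + x²/2) = 1 + x⁴/4 ≥ 1, this follows from exp x ≥ 1 + x + x²/2.
  have hexp : ∀ x : ℝ, 0 ≤ x → Real.exp (-x) ≤ 1 - x + x ^ 2 / 2 := by
    intro x hx
    rw [Real.exp_neg, inv_le_comm₀ (Real.exp_pos _) (by nlinarith [sq_nonneg (x - 1)])]
    refine le_trans ?_ (Real.quadratic_le_exp_of_nonneg hx)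
    rw [inv_le_iff_one_le_mul₀ (by nlinarith [sq_nonneg (x - 1)])]
    nlinarith [sq_nonneg (x ^ 2)]
  have hc : ∑ _σ : ι → Bool, (1 : ℝ) = 2 ^ Fintype.card ι := by simp
  calc ∑ σ : ι → Bool, Real.exp (-(s * signedSum σ u ^ 2))
      ≤ ∑ σ : ι → Bool, (1 - s * signedSum σ u ^ 2 + s ^ 2 / 2 * signedSum σ u ^ 4) := by
        refine Finset.sum_le_sum fun σ _ => (hexp _ (by positivity)).trans_eq ?_
        ring
    _ = 2 ^ Fintype.card ι - s * (2 ^ Fintype.card ι * 1) +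
          s ^ 2 / 2 * ∑ σ : ι → Bool, signedSum σ u ^ 4 := by
        rw [Finset.sum_add_distrib, Finset.sum_sub_distrib, ← Finset.mul_sum, ← Finset.mul_sum,
          hc, ← h2]
        rfl
    _ ≤ 2 ^ Fintype.card ι - s * (2 ^ Fintype.card ι * 1) +
          s ^ 2 / 2 * (2 ^ Fintype.card ι * (3 * 1 ^ 2)) := by
        gcongr
        exact h4
    _ = 2 ^ Fintype.card ι * ((-s + 3 / 2 * s ^ 2) + 1) := by ring
    _ ≤ _ := by
        gcongr
        exact Real.add_one_le_exp _

/-- The exponential Markov inequality for sums of independent variables, as a count. -/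
theorem card_le_sum_le {β : Type*} [Fintype β] (t : ℕ) (f : β → ℝ) (c : ℝ) :
    ((Finset.univ.filter fun σ : Fin t → β => c ≤ ∑ i, f (σ i)).card : ℝ) ≤
      Real.exp (-c) * (∑ b, Real.exp (f b)) ^ t := by
  rw [Fintype.sum_pow, Finset.mul_sum, Finset.card_eq_sum_ones, Nat.cast_sum,
    Finset.sum_filter]
  refine Finset.sum_le_sum fun σ _ => ?_
  rw [← Real.exp_sum, ← Real.exp_add]
  split_ifs with h
  · rw [Nat.cast_one]
    exact Real.one_le_exp (by linarith)
  · exact (Real.exp_pos _).le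

/-- Chernoff bound with s = α/3. Both tails have the exponent -sα + 3s²/2 per row, and this s
minimises it, giving -α²/6. -/
theorem card_signs_deviation_le {u : ι → ℝ} (hu : ∑ j, u j ^ 2 = 1) {α : ℝ} (hα : 0 < α)
    (hα' : α ≤ 1 / 24) (t : ℕ) :
    ((Finset.univ.filter fun σ : Fin t → ι → Bool =>
        α * t < |∑ i, signedSum (σ i) u ^ 2 - t|).card : ℝ) ≤
      Fintype.card (Fin t → ι → Bool) * (2 * Real.exp (-(t * α ^ 2 / 6))) := by
  set M : ℝ := 2 ^ Fintype.card ι with hM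
  have hcard : (Fintype.card (Fin t → ι → Bool) : ℝ) = M ^ t := by simp [hM]
  have hup := card_le_sum_le t (fun σ : ι → Bool => α / 3 * signedSum σ u ^ 2)
    (α / 3 * ((1 + α) * t))
  have hlo := card_le_sum_le t (fun σ : ι → Bool => -(α / 3 * signedSum σ u ^ 2))
    (-(α / 3 * ((1 - α) * t)))
  have hup' : Real.exp (-(α / 3 * ((1 + α) * t))) *
      (∑ σ : ι → Bool, Real.exp (α / 3 * signedSum σ u ^ 2)) ^ t ≤
      M ^ t * Real.exp (-(t * α ^ 2 / 6)) := by
    have h := (sum_exp_mul_signedSum_sq_le hu (s := α / 3) (by positivity) (by linarith)).trans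
      (mul_le_mul_of_nonneg_left (sqrt_one_div_le_exp (s := α / 3) (by positivity) (by linarith))
        (by positivity))
    refine (mul_le_mul_of_nonneg_left (pow_le_pow_left₀
      (Finset.sum_nonneg fun _ _ => (Real.exp_pos _).le) h t) (Real.exp_pos _).le).trans_eq ?_
    rw [mul_pow, ← Real.exp_nat_mul, mul_left_comm, ← Real.exp_add]
    congr 2
    ring
  have hlo' : Real.exp (-(-(α / 3 * ((1 - α) * t)))) *
      (∑ σ : ι → Bool, Real.exp (-(α / 3 * signedSum σ u ^ 2))) ^ t ≤
      M ^ t * Real.exp (-(t * α ^ 2 / 6)) := by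
    have h := sum_exp_neg_mul_signedSum_sq_le hu (s := α / 3) (by positivity)
    refine (mul_le_mul_of_nonneg_left (pow_le_pow_left₀
      (Finset.sum_nonneg fun _ _ => (Real.exp_pos _).le) h t) (Real.exp_pos _).le).trans_eq ?_
    rw [mul_pow, ← Real.exp_nat_mul, mul_left_comm, ← Real.exp_add]
    congr 2
    ring
  have hsub : (Finset.univ.filter fun σ : Fin t → ι → Bool =>
        α * t < |∑ i, signedSum (σ i) u ^ 2 - t|) ⊆
      (Finset.univ.filter fun σ : Fin t → ι → Bool =>
        α / 3 * ((1 + α) * t) ≤ ∑ i, α / 3 * signedSum (σ i) u ^ 2) ∪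
      (Finset.univ.filter fun σ : Fin t → ι → Bool =>
        -(α / 3 * ((1 - α) * t)) ≤ ∑ i, -(α / 3 * signedSum (σ i) u ^ 2)) := by
    intro σ hσ
    simp only [Finset.mem_union, Finset.mem_filter, Finset.mem_univ, true_and,
      ← Finset.mul_sum, Finset.sum_neg_distrib, neg_le_neg_iff] at hσ ⊢
    rcases lt_abs.1 hσ with h | h
    · exact Or.inl (mul_le_mul_of_nonneg_left (by linarith) (by positivity))
    · exact Or.inr (mul_le_mul_of_nonneg_left (by linarith) (by positivity))
  have hc : ((Finset.univ.filter fun σ : Fin t → ι → Bool =>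
        α * t < |∑ i, signedSum (σ i) u ^ 2 - t|).card : ℝ) ≤ _ :=
    (Nat.cast_le.2 ((Finset.card_le_card hsub).trans (Finset.card_union_le _ _)))
  rw [Nat.cast_add] at hc
  rw [hcard]
  linarith

end Signs

/-! ### Random projections -/

theorem signMatrix_mulVec {ι : Type*} [Fintype ι] {t : ℕ} (σ : Fin t → ι → Bool) (v : ι → ℝ)
    (i : Fin t) : (signMatrix σ *ᵥ v) i = signedSum (σ i) v / √t := by
  rw [Matrix.mulVec, dotProduct, signedSum, Finset.sum_div]
  refine Finset.sum_congr rfl fun j _ => ?_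
  simp only [signMatrix, Matrix.of_apply]
  split_ifs <;> ring

theorem signedSum_smul {ι : Type*} [Fintype ι] (σ : ι → Bool) (c : ℝ) (v : ι → ℝ) :
    signedSum σ (fun j => c * v j) = c * signedSum σ v := by
  rw [signedSum, signedSum, Finset.mul_sum]
  exact Finset.sum_congr rfl fun j _ => by split_ifs <;> ring

theorem sum_sq_signMatrix {ι : Type*} [Fintype ι] {t : ℕ} (ht : 0 < t)
    (σ : Fin t → ι → Bool) :
    ∑ i, ∑ j, signMatrix σ i j ^ 2 = Fintype.card ι := by
  have ht' : (0 : ℝ) < t := Nat.cast_pos.2 ht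
  have : ∀ i j, signMatrix σ i j ^ 2 = 1 / (t : ℝ) := by
    intro i j
    simp only [signMatrix, Matrix.of_apply]
    split_ifs <;> simp [Real.sq_sqrt ht'.le]
  simp only [this]
  simp
  field_simp

/-- The squared length of a fixed vector is preserved by a random sign matrix up to a factor
`1 ± α`, except with a small probability. -/
theorem card_signMatrix_distortion_le {ι : Type*} [Fintype ι] [DecidableEq ι] {α : ℝ}
    (hα : 0 < α) (hα' : α ≤ 1 / 24) {t : ℕ} (ht : 0 < t) (v : ι → ℝ) :
    ((Finset.univ.filter fun σ : Fin t → ι → Bool =>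
        α * ∑ j, v j ^ 2 < |∑ i, (signMatrix σ *ᵥ v) i ^ 2 - ∑ j, v j ^ 2|).card : ℝ) ≤
      Fintype.card (Fin t → ι → Bool) * (2 * Real.exp (-(t * α ^ 2 / 6))) := by
  have ht' : (0 : ℝ) < t := Nat.cast_pos.2 ht
  -- The claim is homogeneous in `v`, so it reduces to unit vectors; for `v = 0` the strict
  -- inequality makes the bad set empty.
  rcases (Finset.sum_nonneg fun j _ => sq_nonneg (v j) : 0 ≤ ∑ j, v j ^ 2).eq_or_lt with h0 | h0
  · have hv : v = 0 := by
      funext j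
      simpa using (Finset.sum_eq_zero_iff_of_nonneg fun j _ => sq_nonneg (v j)).1 h0.symm j
    subst hv
    simp
    positivity
  · set S := ∑ j, v j ^ 2 with hS
    have hu : ∑ j, ((√S)⁻¹ * v j) ^ 2 = 1 := by
      simp only [mul_pow, ← Finset.mul_sum, inv_pow, Real.sq_sqrt h0.le]
      exact inv_mul_cancel₀ h0.ne'
    refine le_of_eq_of_le ?_ (card_signs_deviation_le hu hα hα' t)
    congr 2
    refine Finset.filter_congr fun σ _ => ?_
    simp only [signMatrix_mulVec, signedSum_smul, div_pow, mul_pow, ← Finset.sum_div,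
      ← Finset.mul_sum, inv_pow, Real.sq_sqrt h0.le, Real.sq_sqrt ht'.le]
    set A := ∑ i, signedSum (σ i) v ^ 2
    have : A / t - S = (S / t) * (S⁻¹ * A - t) := by field_simp
    rw [this, abs_mul, abs_of_pos (by positivity), show α * S = S / t * (α * t) by field_simp]
    exact mul_lt_mul_iff_right₀ (by positivity)

/-- Union bound over the vectors `v k`. The Frobenius norm costs nothing, as every sign matrix has
entries of square 1/t; it is recorded for the later estimate of the solver error. -/
theorem toOuterMeasure_randomSignMatrix_compl_le {ι κ : Type*} [Fintype ι] [DecidableEq ι]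
    [Fintype κ] {α : ℝ} (hα : 0 < α) (hα' : α ≤ 1 / 24) {t : ℕ} (ht : 0 < t)
    (v : κ → ι → ℝ) :
    (randomSignMatrix t ι).toOuterMeasure
      {M | (∀ k, |∑ i, (M *ᵥ v k) i ^ 2 - ∑ j, v k j ^ 2| ≤ α * ∑ j, v k j ^ 2) ∧
        ∑ i, ∑ j, M i j ^ 2 = Fintype.card ι}ᶜ ≤
      ENNReal.ofReal (Fintype.card κ * (2 * Real.exp (-(t * α ^ 2 / 6)))) := by
  classical
  rw [randomSignMatrix, PMF.toOuterMeasure_map_apply]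
  set B : κ → Finset (Fin t → ι → Bool) := fun k => Finset.univ.filter fun σ =>
    α * ∑ j, v k j ^ 2 < |∑ i, (signMatrix σ *ᵥ v k) i ^ 2 - ∑ j, v k j ^ 2| with hB
  refine (MeasureTheory.measure_mono (t := ((Finset.univ.biUnion B : Finset _) : Set _))
    fun σ hσ => ?_).trans ?_
  · simp only [Set.mem_preimage, Set.mem_compl_iff, Set.mem_ofPred_eq, not_and_or, not_forall,
      sum_sq_signMatrix ht, not_true, or_false, not_le] at hσ
    simpa [hB] using hσ
  · rw [PMF.toOuterMeasure_uniformOfFintype_apply]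
    have hc : ((Finset.univ.biUnion B).card : ℝ) ≤
        Fintype.card (Fin t → ι → Bool) *
          (Fintype.card κ * (2 * Real.exp (-(t * α ^ 2 / 6)))) := by
      calc ((Finset.univ.biUnion B).card : ℝ) ≤ ∑ k, ((B k).card : ℝ) := by
            exact_mod_cast Finset.card_biUnion_le
        _ ≤ ∑ _k : κ, (Fintype.card (Fin t → ι → Bool) *
              (2 * Real.exp (-(t * α ^ 2 / 6)))) :=
            Finset.sum_le_sum fun k _ => card_signMatrix_distortion_le hα hα' ht (v k)
        _ = _ := by
            rw [Finset.sum_const, Finset.card_univ, nsmul_eq_mul]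
            ring
    have hpos : (0 : ℝ) < Fintype.card (Fin t → ι → Bool) := Nat.cast_pos.2 Fintype.card_pos
    rw [← ENNReal.ofReal_natCast, ← ENNReal.ofReal_natCast, ← ENNReal.ofReal_div_of_pos hpos]
    refine ENNReal.ofReal_le_ofReal ?_
    rw [div_le_iff₀ hpos, mul_comm]
    have hcard := Fintype.card_coe (Finset.univ.biUnion B)
    rw [← hcard] at hc
    exact (congrArg Nat.cast
      (Fintype.card_congr (Equiv.subtypeEquivRight fun σ => Finset.mem_coe))).trans_le hc

/-! ### Dirichlet forms of graphs -/

/-- The squared difference of `x` along an unordered pair. -/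
def sqDiff {α : Type*} (x : α → ℝ) : Sym2 α → ℝ :=
  Sym2.lift ⟨fun a b => (x a - x b) ^ 2, fun a b => by ring⟩

theorem sqDiff_mk {α : Type*} (x : α → ℝ) (a b : α) : sqDiff x s(a, b) = (x a - x b) ^ 2 := rfl

theorem sqDiff_nonneg {α : Type*} (x : α → ℝ) (e : Sym2 α) : 0 ≤ sqDiff x e := by
  induction e using Sym2.ind with
  | _ a b => exact sq_nonneg _

theorem sum_edgeFinset_sqDiff {α : Type*} [Fintype α] [DecidableEq α] (H : SimpleGraph α)
    [DecidableRel H.Adj] (x : α → ℝ) :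
    ∑ e ∈ H.edgeFinset, sqDiff x e = x ⬝ᵥ (H.lapMatrix ℝ *ᵥ x) := by
  have h := SimpleGraph.lapMatrix_toLinearMap₂' ℝ H x
  rw [Matrix.toLinearMap₂'_apply'] at h
  rw [h, eq_div_iff two_ne_zero]
  have h1 : ∑ d : H.Dart, sqDiff x d.edge = ∑ e ∈ H.edgeFinset, sqDiff x e * 2 := by
    rw [← Finset.sum_fiberwise_of_maps_to (s := Finset.univ) (t := H.edgeFinset)
      (g := fun d : H.Dart => d.edge) fun d _ => by simp]
    refine Finset.sum_congr rfl fun e he => ?_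
    rw [Finset.sum_congr rfl (g := fun _ => sqDiff x e)
      fun d hd => by rw [(Finset.mem_filter.1 hd).2], Finset.sum_const,
      H.dart_edge_fiber_card e (by simpa using he), nsmul_eq_mul, mul_comm]
    norm_num
  have h2 : ∑ d : H.Dart, sqDiff x d.edge =
      ∑ i, ∑ j, if H.Adj i j then (x i - x j) ^ 2 else 0 := by
    rw [← Finset.sum_product', ← Finset.sum_filter]
    refine Finset.sum_nbij (fun d => d.toProd) (fun d _ => by simp)
      (fun d _ d' _ h => SimpleGraph.Dart.ext _ _ h) (fun p hp => ?_) fun d _ => rfl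
    simp only [Finset.univ_product_univ, Finset.coe_filter, Finset.mem_univ, true_and,
      Set.mem_ofPred_eq] at hp
    exact ⟨⟨p, hp⟩, by simp⟩
  rw [Finset.sum_mul, ← h1, h2]

/-- Cauchy–Schwarz along a walk. If ℓ is the length of the tail, S² ≤ ℓT gives 2dS ≤ ℓd² + T; this
divides by ℓ, so a tail of length 0 is separate. -/
theorem sq_sub_le_length_mul_sum {α : Type*} {H : SimpleGraph α} (x : α → ℝ) {a b : α}
    (w : H.Walk a b) :
    (x a - x b) ^ 2 ≤ w.length * (w.edges.map (sqDiff x)).sum := by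
  induction w with
  | nil => simp
  | @cons a c b h w ih =>
    simp only [SimpleGraph.Walk.length_cons, SimpleGraph.Walk.edges_cons, List.map_cons,
      List.sum_cons, sqDiff_mk]
    set T := (w.edges.map (sqDiff x)).sum
    set d := x a - x c
    set S := x c - x b
    have e : x a - x b = d + S := by simp [d, S]
    rw [e]
    push_cast
    rcases Nat.eq_zero_or_pos w.length with h0 | h0
    · rw [h0] at ih ⊢
      have hT : 0 ≤ T := List.sum_nonneg fun y hy => by
        obtain ⟨e, _, rfl⟩ := List.mem_map.1 hy
        exact sqDiff_nonneg x e
      have hS : S = 0 := by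
        have : S ^ 2 ≤ 0 := by simpa using ih
        exact pow_eq_zero_iff two_ne_zero |>.1 (le_antisymm this (sq_nonneg S))
      rw [hS]
      simp
      exact hT
    · have hl : (0 : ℝ) < w.length := Nat.cast_pos.2 h0
      have h1 : 2 * d * S ≤ w.length * d ^ 2 + T := by
        rw [← sub_nonneg]
        refine nonneg_of_mul_nonneg_right (a := (w.length : ℝ)) ?_ hl
        nlinarith [sq_nonneg (w.length * d - S)]
      nlinarith

/-- The edges of a path are distinct and fewer than |V|, so the path energy is at most the whole
Dirichlet energy. -/
theorem sq_sub_le_card_mul_lapMatrix {α : Type*} [Fintype α] [DecidableEq α]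
    {H : SimpleGraph α} [DecidableRel H.Adj] (hH : H.Connected) (x : α → ℝ) (a b : α) :
    (x a - x b) ^ 2 ≤ Fintype.card α * (x ⬝ᵥ (H.lapMatrix ℝ *ᵥ x)) := by
  obtain ⟨w, hw⟩ := (hH.preconnected a b).exists_isPath
  have h1 : (w.edges.map (sqDiff x)).sum ≤ ∑ e ∈ H.edgeFinset, sqDiff x e := by
    rw [← List.sum_toFinset _ hw.isTrail.edges_nodup]
    refine Finset.sum_le_sum_of_subset_of_nonneg (fun e he => ?_)
      fun e _ _ => sqDiff_nonneg x e
    simpa using w.edges_subset_edgeSet (List.mem_toFinset.1 he)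
  have h2 : (w.length : ℝ) ≤ Fintype.card α := Nat.cast_le.2 hw.length_lt.le
  rw [← sum_edgeFinset_sqDiff]
  have h3 : 0 ≤ ∑ e ∈ H.edgeFinset, sqDiff x e := Finset.sum_nonneg fun e _ => sqDiff_nonneg x e
  calc (x a - x b) ^ 2 ≤ _ := sq_sub_le_length_mul_sum x w
    _ ≤ w.length * ∑ e ∈ H.edgeFinset, sqDiff x e := by gcongr
    _ ≤ _ := by gcongr

theorem incidence_mulVec {α : Type*} [Fintype α] [DecidableEq α] {H : SimpleGraph α}
    (o : EdgeOrientation H) (x : α → ℝ) (e : H.edgeSet) :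
    (incidence o *ᵥ x) e = x (o.head e) - x (o.tail e) := by
  have hne : o.tail e ≠ o.head e := by
    have := e.2
    rw [o.ends e, SimpleGraph.mem_edgeSet] at this
    exact this.ne'
  have h : ∀ v, incidence o e v * x v =
      (if v = o.head e then x v else 0) - (if v = o.tail e then x v else 0) := by
    intro v
    simp only [incidence, Matrix.of_apply]
    by_cases h1 : v = o.head e
    · subst h1
      simp [hne.symm]
    · by_cases h2 : v = o.tail e <;> simp [h1, h2]
      simp [hne]
  rw [Matrix.mulVec, dotProduct, Finset.sum_congr rfl fun v _ => h v, Finset.sum_sub_distrib]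
  simp

theorem sum_sq_incidence_mulVec {α : Type*} [Fintype α] [DecidableEq α] {H : SimpleGraph α}
    [DecidableRel H.Adj] [Fintype H.edgeSet] (o : EdgeOrientation H) (x : α → ℝ) :
    ∑ e, (incidence o *ᵥ x) e ^ 2 = x ⬝ᵥ (H.lapMatrix ℝ *ᵥ x) := by
  rw [← sum_edgeFinset_sqDiff]
  have h : ∀ e : H.edgeSet, (incidence o *ᵥ x) e ^ 2 = sqDiff x e := by
    intro e
    rw [o.ends e, sqDiff_mk, incidence_mulVec]
  rw [Finset.sum_congr rfl fun e _ => h e]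
  exact (Finset.sum_subtype _ (fun e => by simp) _).symm

/-! ### The follower block of the Laplacian -/

section Followers

variable {V : Type*} [DecidableEq V] {G : SimpleGraph V} {S0 S1 : Finset V}

/-- The extension by zero of a function on the followers. -/
def extendZero (v : Follower S0 S1 → ℝ) (i : V) : ℝ :=
  if h : i ∉ S0 ∪ S1 then v ⟨i, h⟩ else 0

theorem extendZero_leader (v : Follower S0 S1 → ℝ) {i : V} (h : i ∈ S0 ∪ S1) :
    extendZero v i = 0 := dif_neg (not_not.2 h)

theorem extendZero_follower (v : Follower S0 S1 → ℝ) (i : Follower S0 S1) :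
    extendZero v i = v i := dif_pos i.2

theorem oneLeaderCount_nonneg (k : Follower S0 S1) : 0 ≤ oneLeaderCount G S0 S1 k :=
  Nat.cast_nonneg _

theorem oneLeaderCount_le_leaderCount (k : Follower S0 S1) :
    oneLeaderCount G S0 S1 k ≤ leaderCount G S0 S1 k := by
  classical
  exact Nat.cast_le.2 (Finset.card_le_card
    (Finset.filter_subset_filter _ Finset.subset_union_right))

variable [Fintype V]

theorem sum_leaders_add_sum_followers (f : V → ℝ) :
    ∑ i ∈ S0 ∪ S1, f i + ∑ i : Follower S0 S1, f i = ∑ i, f i := by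
  rw [← Finset.sum_compl_add_sum (S0 ∪ S1) f, add_comm]
  congr 1
  exact (Finset.sum_subtype _ (fun i => by rw [Finset.mem_compl]) f).symm

theorem sum_extendZero_mul (v : Follower S0 S1 → ℝ) (f : V → ℝ) :
    ∑ i, f i * extendZero v i = ∑ i : Follower S0 S1, f i * v i := by
  rw [← sum_leaders_add_sum_followers (S0 := S0) (S1 := S1),
    Finset.sum_eq_zero fun i hi => by rw [extendZero_leader v hi, mul_zero], zero_add]
  simp only [extendZero_follower]

theorem lapMatrix_mulVec_eq_sum {α : Type*} [Fintype α] [DecidableEq α] (H : SimpleGraph α)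
    [DecidableRel H.Adj] (x : α → ℝ) (i : α) :
    (H.lapMatrix ℝ *ᵥ x) i = ∑ j ∈ H.neighborFinset i, (x i - x j) := by
  rw [SimpleGraph.lapMatrix_mulVec_apply, Finset.sum_sub_distrib, Finset.sum_const,
    SimpleGraph.card_neighborFinset_eq_degree, nsmul_eq_mul]

open scoped Classical in
theorem followerLaplacian_mulVec (v : Follower S0 S1 → ℝ) (k : Follower S0 S1) :
    (followerLaplacian G S0 S1 *ᵥ v) k =
      ∑ j ∈ G.neighborFinset k, (extendZero v k - extendZero v j) := by
  rw [← lapMatrix_mulVec_eq_sum, Matrix.mulVec, Matrix.mulVec, dotProduct, dotProduct,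
    sum_extendZero_mul]
  rfl

open scoped Classical in
theorem dotProduct_followerLaplacian (v : Follower S0 S1 → ℝ) :
    v ⬝ᵥ (followerLaplacian G S0 S1 *ᵥ v) =
      extendZero v ⬝ᵥ (G.lapMatrix ℝ *ᵥ extendZero v) := by
  rw [dotProduct_comm (extendZero v), dotProduct_comm v, dotProduct, dotProduct,
    sum_extendZero_mul]
  simp only [followerLaplacian_mulVec, lapMatrix_mulVec_eq_sum]

theorem isSymm_followerLaplacian : (followerLaplacian G S0 S1).IsSymm := by
  classical
  exact (SimpleGraph.isSymm_lapMatrix (R := ℝ) G).submatrix _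

/-- Compare j with a leader, where the extension by zero vanishes. This yields positive definiteness
and the bound r ≤ n. -/
theorem sq_le_card_mul_followerLaplacian (hG : G.Connected) (hS : (S0 ∪ S1).Nonempty)
    (v : Follower S0 S1 → ℝ) (j : Follower S0 S1) :
    v j ^ 2 ≤ Fintype.card V * (v ⬝ᵥ (followerLaplacian G S0 S1 *ᵥ v)) := by
  classical
  obtain ⟨s, hs⟩ := hS
  have h := sq_sub_le_card_mul_lapMatrix hG (extendZero v) j s
  rwa [extendZero_leader v hs, extendZero_follower, sub_zero,
    ← dotProduct_followerLaplacian] at h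

theorem posDef_followerLaplacian (hG : G.Connected) (hS : (S0 ∪ S1).Nonempty) :
    (followerLaplacian G S0 S1).PosDef := by
  refine Matrix.PosDef.of_dotProduct_mulVec_pos ?_ fun v hv => ?_
  · rw [Matrix.IsHermitian, Matrix.conjTranspose_eq_transpose_of_trivial]
    exact isSymm_followerLaplacian
  · obtain ⟨j, hj⟩ := Function.ne_iff.1 hv
    have h := sq_le_card_mul_followerLaplacian hG hS v j
    have h2 : 0 < v j ^ 2 := sq_pos_of_ne_zero hj
    rw [star_trivial]
    exact pos_of_mul_pos_right (h2.trans_le h) (Nat.cast_nonneg _)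

theorem followerLaplacian_apply_ne {i j : Follower S0 S1} (h : i ≠ j) [Decidable (G.Adj i j)] :
    followerLaplacian G S0 S1 i j = if G.Adj i j then -1 else 0 := by
  have h' : (i : V) ≠ j := fun e => h (Subtype.ext e)
  simp only [followerLaplacian, Matrix.submatrix_apply, SimpleGraph.lapMatrix,
    Matrix.sub_apply, SimpleGraph.degMatrix, Matrix.diagonal_apply_ne _ h',
    SimpleGraph.adjMatrix_apply]
  split_ifs <;> simp

open scoped Classical in
theorem followerLaplacian_apply_self (i : Follower S0 S1) :
    followerLaplacian G S0 S1 i i = G.degree i := by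
  simp [followerLaplacian, SimpleGraph.lapMatrix, SimpleGraph.degMatrix]

theorem followerLaplacian_apply_nonpos {i j : Follower S0 S1} (h : i ≠ j) :
    followerLaplacian G S0 S1 i j ≤ 0 := by
  classical
  rw [followerLaplacian_apply_ne h]
  split_ifs <;> norm_num

theorem followerLaplacian_apply_self_le (i : Follower S0 S1) :
    followerLaplacian G S0 S1 i i ≤ Fintype.card V := by
  classical
  rw [followerLaplacian_apply_self]
  exact Nat.cast_le.2 (G.degree_lt_card_verts i).le

theorem sum_neighborFinset_eq_sum_ite {α : Type*} [Fintype α] (H : SimpleGraph α)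
    [DecidableRel H.Adj] (i : α) (f : α → ℝ) :
    ∑ j ∈ H.neighborFinset i, f j = ∑ j, if H.Adj i j then f j else 0 := by
  rw [← Finset.sum_filter]
  congr 1
  ext j
  simp

theorem isSDD_followerLaplacian : IsSDD (followerLaplacian G S0 S1) := by
  classical
  refine ⟨isSymm_followerLaplacian, fun i => ?_⟩
  calc ∑ j ∈ Finset.univ.erase i, |followerLaplacian G S0 S1 i j|
      = ∑ j ∈ Finset.univ.erase i, if G.Adj i j then (1 : ℝ) else 0 := by
        refine Finset.sum_congr rfl fun j hj => ?_
        rw [followerLaplacian_apply_ne (Finset.ne_of_mem_erase hj).symm]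
        split_ifs <;> simp
    _ ≤ ∑ j : Follower S0 S1, if G.Adj i j then (1 : ℝ) else 0 :=
        Finset.sum_le_sum_of_subset_of_nonneg (Finset.erase_subset _ _)
          fun j _ _ => by split_ifs <;> norm_num
    _ ≤ ∑ j, if G.Adj i j then (1 : ℝ) else 0 := by
        rw [← sum_leaders_add_sum_followers (S0 := S0) (S1 := S1)]
        exact le_add_of_nonneg_left (Finset.sum_nonneg fun j _ => by split_ifs <;> norm_num)
    _ = followerLaplacian G S0 S1 i i := by
        rw [← sum_neighborFinset_eq_sum_ite, followerLaplacian_apply_self]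
        simp

open scoped Classical in
theorem followerLaplacian_mulVec_eq_add [DecidableRel (followerGraph G S0 S1).Adj] (v : Follower S0 S1 → ℝ) (k : Follower S0 S1) :
    (followerLaplacian G S0 S1 *ᵥ v) k =
      ((followerGraph G S0 S1).lapMatrix ℝ *ᵥ v) k + leaderCount G S0 S1 k * v k := by
  rw [followerLaplacian_mulVec, sum_neighborFinset_eq_sum_ite,
    ← sum_leaders_add_sum_followers (S0 := S0) (S1 := S1), add_comm,
    lapMatrix_mulVec_eq_sum, sum_neighborFinset_eq_sum_ite]
  congr 1
  · simp only [extendZero_follower, SimpleGraph.comap_adj]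
  · rw [← Finset.sum_filter, Finset.sum_congr rfl (g := fun _ => v k), Finset.sum_const,
      nsmul_eq_mul, leaderCount]
    intro j hj
    rw [extendZero_leader v (Finset.mem_filter.1 hj).1, extendZero_follower, sub_zero]

/-- The identity L = BᵀB + W as quadratic forms. At a Green column the left side is r, which is why
the two projected lengths estimate it. -/
theorem dotProduct_followerLaplacian_eq_add [Fintype (followerGraph G S0 S1).edgeSet]
    (o : EdgeOrientation (followerGraph G S0 S1)) (v : Follower S0 S1 → ℝ) :
    v ⬝ᵥ (followerLaplacian G S0 S1 *ᵥ v) =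
      ∑ e, (incidence o *ᵥ v) e ^ 2 + ∑ i, (sqrtLeaderMatrix G S0 S1 *ᵥ v) i ^ 2 := by
  classical
  rw [sum_sq_incidence_mulVec, dotProduct, dotProduct, ← Finset.sum_add_distrib]
  refine Finset.sum_congr rfl fun k _ => ?_
  have h0 : 0 ≤ leaderCount G S0 S1 k := Nat.cast_nonneg _
  rw [followerLaplacian_mulVec_eq_add, sqrtLeaderMatrix, Matrix.mulVec_diagonal, mul_pow,
    Real.sq_sqrt h0]
  ring_nf

theorem leaderCount_eq_mulVec_one (k : Follower S0 S1) :
    (followerLaplacian G S0 S1 *ᵥ fun _ => 1) k = leaderCount G S0 S1 k := by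
  classical
  rw [followerLaplacian_mulVec_eq_add, lapMatrix_mulVec_eq_sum]
  simp

theorem oneLeaderCount_le_card (k : Follower S0 S1) :
    oneLeaderCount G S0 S1 k ≤ Fintype.card V :=
  Nat.cast_le.2 (Finset.card_le_univ _)

end Followers

/-! ### Positive definite systems -/

section PosDef

variable {ι κ : Type*} [Fintype ι] [Fintype κ] {S : Matrix ι ι ℝ}

theorem dotProduct_mulVec_comm (hS : S.PosDef) (x y : ι → ℝ) :
    x ⬝ᵥ (S *ᵥ y) = y ⬝ᵥ (S *ᵥ x) := by
  have h : Sᵀ = S := by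
    rw [← Matrix.conjTranspose_eq_transpose_of_trivial]
    exact hS.isHermitian
  rw [Matrix.dotProduct_mulVec, ← Matrix.mulVec_transpose, h, dotProduct_comm]

theorem energy_nonneg (hS : S.PosDef) (x : ι → ℝ) : 0 ≤ x ⬝ᵥ (S *ᵥ x) := by
  simpa using hS.posSemidef.dotProduct_mulVec_nonneg x

/-- The minimum principle. -/
theorem nonneg_of_mulVec_nonneg (hS : S.PosDef) (hoff : ∀ i j, i ≠ j → S i j ≤ 0) {v : ι → ℝ}
    (hv : ∀ i, 0 ≤ (S *ᵥ v) i) (i : ι) : 0 ≤ v i := by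
  -- Test against the negative part m of v = w - m. Nonpositive off-diagonal entries give mᵀSw ≤ 0,
  -- so 0 ≤ mᵀSv forces mᵀSm ≤ 0 and m = 0.
  set m : ι → ℝ := fun i => max (-v i) 0
  set w : ι → ℝ := fun i => max (v i) 0
  have hvw : v = w - m := by
    funext i
    simp only [Pi.sub_apply, m, w]
    rcases le_total 0 (v i) with h | h
    · rw [max_eq_left h, max_eq_right (by linarith), sub_zero]
    · rw [max_eq_right h, max_eq_left (by linarith)]
      ring
  have h1 : 0 ≤ m ⬝ᵥ (S *ᵥ v) :=
    Finset.sum_nonneg fun i _ => mul_nonneg (le_max_right _ _) (hv i)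
  have h2 : m ⬝ᵥ (S *ᵥ w) ≤ 0 := by
    refine Finset.sum_nonpos fun i _ => ?_
    rw [Matrix.mulVec, dotProduct, Finset.mul_sum]
    refine Finset.sum_nonpos fun j _ => ?_
    rcases eq_or_ne i j with rfl | hij
    · rcases le_total 0 (v i) with h | h
      · simp [m, h]
      · simp [w, h]
    · exact mul_nonpos_of_nonneg_of_nonpos (le_max_right _ _)
        (mul_nonpos_of_nonpos_of_nonneg (hoff i j hij) (le_max_right _ _))
  rw [hvw, Matrix.mulVec_sub, dotProduct_sub] at h1
  have hm : m = 0 := by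
    by_contra hne
    have := hS.dotProduct_mulVec_pos hne
    rw [star_trivial] at this
    linarith
  have := congrFun hm i
  simp only [m, Pi.zero_apply] at this
  linarith [le_max_left (-v i) 0]

theorem energy_le_of_energyNorm_le (hS : S.PosDef) {x y : ι → ℝ} {δ : ℝ}
    (h : energyNorm S x ≤ δ * energyNorm S y) :
    x ⬝ᵥ (S *ᵥ x) ≤ δ ^ 2 * (y ⬝ᵥ (S *ᵥ y)) := by
  have h2 := pow_le_pow_left₀ (Real.sqrt_nonneg _) h 2
  unfold energyNorm at h2
  rwa [mul_pow, Real.sq_sqrt (energy_nonneg hS _),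
    Real.sq_sqrt (energy_nonneg hS _)] at h2

variable [DecidableEq ι]

theorem mulVec_inv_mulVec (hS : S.PosDef) (y : ι → ℝ) : S *ᵥ (S⁻¹ *ᵥ y) = y := by
  rw [Matrix.mulVec_mulVec, Matrix.mul_nonsing_inv _ ((Matrix.isUnit_iff_isUnit_det S).1 hS.isUnit),
    Matrix.one_mulVec]

/-- The column `j` of the inverse of `S`. -/
noncomputable def greenColumn (S : Matrix ι ι ℝ) (j : ι) : ι → ℝ := S⁻¹ *ᵥ Pi.single j 1

theorem mulVec_greenColumn (hS : S.PosDef) (j : ι) : S *ᵥ greenColumn S j = Pi.single j 1 :=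
  mulVec_inv_mulVec hS _

theorem dotProduct_mulVec_greenColumn (hS : S.PosDef) (v : ι → ℝ) (j : ι) :
    v ⬝ᵥ (S *ᵥ greenColumn S j) = v j := by
  rw [mulVec_greenColumn hS, dotProduct_single_one]

theorem inv_mulVec_apply (hS : S.PosDef) (y : ι → ℝ) (j : ι) :
    (S⁻¹ *ᵥ y) j = y ⬝ᵥ greenColumn S j := by
  rw [← dotProduct_mulVec_greenColumn hS (S⁻¹ *ᵥ y), dotProduct_mulVec_comm hS, mulVec_inv_mulVec hS,
    dotProduct_comm]

theorem greenColumn_self_pos (hS : S.PosDef) (j : ι) : 0 < greenColumn S j j := by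
  rw [← dotProduct_mulVec_greenColumn hS (greenColumn S j) j]
  have hne : greenColumn S j ≠ 0 := by
    intro h
    have h1 := mulVec_greenColumn hS j
    rw [h, Matrix.mulVec_zero] at h1
    simpa using congrFun h1 j
  simpa using hS.dotProduct_mulVec_pos hne

/-- Cauchy–Schwarz for the inner product of S: v_j = ⟨v, g⟩ and ⟨g, g⟩ = g_j. The proof expands the
energy of g_j v - v_j g. -/
theorem sq_apply_le_mul_energy (hS : S.PosDef) (v : ι → ℝ) (j : ι) :
    v j ^ 2 ≤ greenColumn S j j * (v ⬝ᵥ (S *ᵥ v)) := by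
  set g := greenColumn S j
  have hr : 0 < g j := greenColumn_self_pos hS j
  have h := energy_nonneg hS (g j • v - v j • g)
  rw [Matrix.mulVec_sub, Matrix.mulVec_smul, Matrix.mulVec_smul, sub_dotProduct,
    dotProduct_sub, dotProduct_sub, smul_dotProduct, smul_dotProduct, smul_dotProduct,
    smul_dotProduct, dotProduct_smul, dotProduct_smul, dotProduct_smul, dotProduct_smul,
    dotProduct_mulVec_comm hS g v, dotProduct_mulVec_greenColumn hS,
    dotProduct_mulVec_greenColumn hS] at h
  simp only [smul_eq_mul] at h
  have h2 : 0 ≤ g j * (g j * (v ⬝ᵥ (S *ᵥ v)) - v j ^ 2) := by linarith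
  linarith [nonneg_of_mul_nonneg_right h2 hr]

theorem one_le_greenColumn_mul (hS : S.PosDef) (j : ι) : 1 ≤ greenColumn S j j * S j j := by
  simpa using sq_apply_le_mul_energy hS (Pi.single j 1) j

theorem sq_sub_apply_le (hS : S.PosDef) {x z : ι → ℝ} {δ : ℝ}
    (h : energyNorm S (x - z) ≤ δ * energyNorm S z) (j : ι) :
    (x j - z j) ^ 2 ≤ greenColumn S j j * (δ ^ 2 * (z ⬝ᵥ (S *ᵥ z))) :=
  (sq_apply_le_mul_energy hS (x - z) j).trans
    (mul_le_mul_of_nonneg_left (energy_le_of_energyNorm_le hS h) (greenColumn_self_pos hS j).le)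

theorem inv_mulVec_vecMul_apply (hS : S.PosDef) (C : Matrix κ ι ℝ) (y : κ → ℝ) (j : ι) :
    (S⁻¹ *ᵥ (y ᵥ* C)) j = y ⬝ᵥ (C *ᵥ greenColumn S j) := by
  rw [inv_mulVec_apply hS, Matrix.dotProduct_mulVec]

/-- For x = S⁻¹Cᵀy the energy equals y · Cx, at most ‖y‖‖Cx‖ and so at most ‖y‖ times the square
root of the energy itself. -/
theorem energy_inv_mulVec_vecMul_le (hS : S.PosDef) {C : Matrix κ ι ℝ}
    (hC : ∀ v, ∑ k, (C *ᵥ v) k ^ 2 ≤ v ⬝ᵥ (S *ᵥ v)) (y : κ → ℝ) :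
    (S⁻¹ *ᵥ (y ᵥ* C)) ⬝ᵥ (S *ᵥ (S⁻¹ *ᵥ (y ᵥ* C))) ≤ ∑ k, y k ^ 2 := by
  set x := S⁻¹ *ᵥ (y ᵥ* C) with hx
  set q := x ⬝ᵥ (S *ᵥ x) with hq
  have h0 : 0 ≤ q := energy_nonneg hS x
  have h1 : q = y ⬝ᵥ (C *ᵥ x) := by
    rw [hq, hx, mulVec_inv_mulVec hS, ← hx, dotProduct_comm, Matrix.dotProduct_mulVec y C x]
  have h2 : q ^ 2 ≤ (∑ k, y k ^ 2) * q := by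
    calc q ^ 2 = (∑ k, y k * (C *ᵥ x) k) ^ 2 := by rw [h1]; rfl
      _ ≤ (∑ k, y k ^ 2) * ∑ k, (C *ᵥ x) k ^ 2 := Finset.sum_mul_sq_le_sq_mul_sq _ _ _
      _ ≤ _ := mul_le_mul_of_nonneg_left (hC x) (Finset.sum_nonneg fun k _ => sq_nonneg _)
  rcases h0.eq_or_lt with h | h
  · rw [← h]
    exact Finset.sum_nonneg fun k _ => sq_nonneg _
  · rw [sq] at h2
    exact le_of_mul_le_mul_right h2 h

theorem sum_sq_sub_projection_le (hS : S.PosDef) {C : Matrix κ ι ℝ}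
    (hC : ∀ v, ∑ k, (C *ᵥ v) k ^ 2 ≤ v ⬝ᵥ (S *ᵥ v)) {t : ℕ} (P : Matrix (Fin t) κ ℝ)
    {X : Fin t → ι → ℝ} {δ : ℝ}
    (hX : ∀ i, energyNorm S (X i - S⁻¹ *ᵥ (P * C) i) ≤ δ * energyNorm S (S⁻¹ *ᵥ (P * C) i))
    (j : ι) :
    ∑ i, (X i j - (P *ᵥ (C *ᵥ greenColumn S j)) i) ^ 2 ≤
      greenColumn S j j * (δ ^ 2 * ∑ i, ∑ k, P i k ^ 2) := by
  rw [Finset.mul_sum, Finset.mul_sum]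
  refine Finset.sum_le_sum fun i _ => ?_
  have hrow : (P * C) i = P i ᵥ* C := rfl
  have h := sq_sub_apply_le hS (hX i) j
  rw [hrow, inv_mulVec_vecMul_apply hS] at h
  refine h.trans ?_
  have := energy_inv_mulVec_vecMul_le hS hC (P i)
  have hr := (greenColumn_self_pos hS j).le
  gcongr

end PosDef

/-! ### Equilibrium opinions -/

section Equilibrium

variable {V : Type*} [Fintype V] [DecidableEq V] {G : SimpleGraph V} {S0 S1 : Finset V}

theorem inv_mulVec_nonneg (hG : G.Connected) (hS : (S0 ∪ S1).Nonempty)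
    {y : Follower S0 S1 → ℝ} (hy : ∀ i, 0 ≤ y i) (i : Follower S0 S1) :
    0 ≤ ((followerLaplacian G S0 S1)⁻¹ *ᵥ y) i := by
  have hL := posDef_followerLaplacian hG hS
  refine nonneg_of_mulVec_nonneg hL (fun i j h => followerLaplacian_apply_nonpos h) ?_ i
  rwa [mulVec_inv_mulVec hL]

open scoped Classical in
/-- The opinions converge to the function with the leaders' values that is harmonic at the
followers. -/
theorem tendsto_opinion (hG : G.Connected) (hS : (S0 ∪ S1).Nonempty)
    (x0 : Follower S0 S1 → ℝ) {y : V → ℝ}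
    (hy : ∀ i ∈ S0 ∪ S1, y i = if i ∈ S1 then 1 else 0)
    (hy' : ∀ i ∉ S0 ∪ S1, ∑ j ∈ G.neighborFinset i, (y i - y j) = 0) :
    Filter.Tendsto (opinion G S0 S1 x0) Filter.atTop (nhds y) := by
  have hL := posDef_followerLaplacian hG hS
  -- H is the weight that makes averaging a contraction: the neighbour average of H at a follower is
  -- H - 1/deg.
  set H : V → ℝ := extendZero ((followerLaplacian G S0 S1)⁻¹ *ᵥ fun _ => 1) with hH
  have hH0 : ∀ i, 0 ≤ H i := by
    intro i
    rw [hH, extendZero]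
    split_ifs
    · exact le_rfl
    · exact inv_mulVec_nonneg hG hS (fun _ => zero_le_one) _
  have hHeq : ∀ i ∉ S0 ∪ S1, ∑ j ∈ G.neighborFinset i, H j = G.degree i * H i - 1 := by
    intro i hi
    have h := followerLaplacian_mulVec (G := G)
      ((followerLaplacian G S0 S1)⁻¹ *ᵥ fun _ => 1) ⟨i, hi⟩
    rw [mulVec_inv_mulVec hL, Finset.sum_sub_distrib, Finset.sum_const,
      SimpleGraph.card_neighborFinset_eq_degree, nsmul_eq_mul] at h
    linarith
  have hpos : ∀ i ∉ S0 ∪ S1, 0 < (G.degree i : ℝ) ∧ 0 < H i := by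
    intro i hi
    have h1 : 0 < G.degree i * H i := by
      linarith [hHeq i hi, Finset.sum_nonneg fun j (_ : j ∈ G.neighborFinset i) => hH0 j]
    exact ⟨pos_of_mul_pos_left h1 (hH0 i), pos_of_mul_pos_right h1 (Nat.cast_nonneg _)⟩
  set M : ℝ := Fintype.card V * (1 + ∑ i, H i) with hM
  have hn : (0 : ℝ) < Fintype.card V := Nat.cast_pos.2 (Fintype.card_pos_iff.2 hG.nonempty)
  have hsum : 0 ≤ ∑ i, H i := Finset.sum_nonneg fun i _ => hH0 i
  have hM0 : 0 < M := by positivity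
  -- As deg · H ≤ M, subtracting 1 from deg · H shrinks it at least by the factor 1 - 1/M.
  set ρ : ℝ := max 0 (1 - 1 / M) with hρ
  have hρ1 : ρ < 1 := max_lt zero_lt_one (by linarith [one_div_pos.2 hM0])
  have hρ0 : 0 ≤ ρ := le_max_left _ _
  have hcontr : ∀ i ∉ S0 ∪ S1, ∑ j ∈ G.neighborFinset i, H j ≤ ρ * (G.degree i * H i) := by
    intro i hi
    rw [hHeq i hi]
    have h1 : (G.degree i : ℝ) * H i ≤ M := by
      rw [hM]
      have hd : (G.degree i : ℝ) ≤ Fintype.card V := Nat.cast_le.2 (G.degree_lt_card_verts i).le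
      have hs : H i ≤ 1 + ∑ i, H i := by
        linarith [Finset.single_le_sum (fun j _ => hH0 j) (Finset.mem_univ i)]
      exact mul_le_mul hd hs (hH0 i) hn.le
    have h0 : 0 ≤ (G.degree i : ℝ) * H i := mul_nonneg (Nat.cast_nonneg _) (hH0 i)
    have h2 : (1 - 1 / M) * (G.degree i * H i) ≤ ρ * (G.degree i * H i) :=
      mul_le_mul_of_nonneg_right (le_max_right _ _) h0
    refine le_trans ?_ h2
    have h3 : 1 / M * (G.degree i * H i) ≤ 1 := by
      rw [one_div, inv_mul_le_iff₀ hM0, mul_one]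
      exact h1
    linarith
  -- At leaders H = 0 and the quotient is 0 by convention; the difference vanishes there anyway.
  set K : ℝ := ∑ i, |opinion G S0 S1 x0 0 i - y i| / H i with hK
  have hK0 : 0 ≤ K := Finset.sum_nonneg fun i _ => div_nonneg (abs_nonneg _) (hH0 i)
  have hlead : ∀ t, ∀ i ∈ S0 ∪ S1, opinion G S0 S1 x0 t i - y i = 0 := by
    intro t i hi
    cases t <;> simp [opinion, hi, hy i hi]
  have hbound : ∀ t i, |opinion G S0 S1 x0 t i - y i| ≤ K * ρ ^ t * H i := by
    intro t
    induction t with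
    | zero =>
      intro i
      by_cases hi : i ∈ S0 ∪ S1
      · rw [hlead 0 i hi, abs_zero]
        have := hH0 i
        positivity
      · rw [pow_zero, mul_one, ← div_le_iff₀ (hpos i hi).2]
        exact Finset.single_le_sum
          (f := fun i => |opinion G S0 S1 x0 0 i - y i| / H i)
          (fun j _ => div_nonneg (abs_nonneg _) (hH0 j)) (Finset.mem_univ i)
    | succ t ih =>
      intro i
      by_cases hi : i ∈ S0 ∪ S1
      · rw [hlead _ i hi, abs_zero]
        have := hH0 i
        positivity
      · have hd := (hpos i hi).1
        have hyi : y i = (∑ j ∈ G.neighborFinset i, y j) / G.degree i := by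
          have h := hy' i hi
          rw [Finset.sum_sub_distrib, Finset.sum_const,
            SimpleGraph.card_neighborFinset_eq_degree, nsmul_eq_mul] at h
          rw [eq_div_iff hd.ne']
          linarith
        have hop : opinion G S0 S1 x0 (t + 1) i - y i =
            (∑ j ∈ G.neighborFinset i, (opinion G S0 S1 x0 t j - y j)) / G.degree i := by
          rw [Finset.sum_sub_distrib, sub_div, ← hyi]
          simp only [opinion, if_neg hi]
        rw [hop, abs_div, abs_of_pos hd, div_le_iff₀ hd]
        calc |∑ j ∈ G.neighborFinset i, (opinion G S0 S1 x0 t j - y j)|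
            ≤ ∑ j ∈ G.neighborFinset i, |opinion G S0 S1 x0 t j - y j| :=
              Finset.abs_sum_le_sum_abs _ _
          _ ≤ ∑ j ∈ G.neighborFinset i, K * ρ ^ t * H j := Finset.sum_le_sum fun j _ => ih j
          _ = K * ρ ^ t * ∑ j ∈ G.neighborFinset i, H j := by rw [Finset.mul_sum]
          _ ≤ K * ρ ^ t * (ρ * (G.degree i * H i)) :=
              mul_le_mul_of_nonneg_left (hcontr i hi) (by positivity)
          _ = _ := by ring
  rw [tendsto_pi_nhds]
  intro i
  rw [tendsto_iff_dist_tendsto_zero]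
  refine squeeze_zero (fun t => dist_nonneg) (fun t => hbound t i) ?_
  have := ((tendsto_pow_atTop_nhds_zero_of_lt_one hρ0 hρ1).const_mul K).mul_const (H i)
  simpa using this

/-- The equilibrium opinions as a solution of the grounded Laplacian system. -/
noncomputable def harmonicOpinion (G : SimpleGraph V) (S0 S1 : Finset V) (i : V) : ℝ :=
  (if i ∈ S1 then 1 else 0) +
    extendZero ((followerLaplacian G S0 S1)⁻¹ *ᵥ oneLeaderCount G S0 S1) i

theorem harmonicOpinion_leader {i : V} (hi : i ∈ S0 ∪ S1) :
    harmonicOpinion G S0 S1 i = if i ∈ S1 then 1 else 0 := by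
  rw [harmonicOpinion, extendZero_leader _ hi, add_zero]

theorem harmonicOpinion_follower (i : Follower S0 S1) :
    harmonicOpinion G S0 S1 i =
      ((followerLaplacian G S0 S1)⁻¹ *ᵥ oneLeaderCount G S0 S1) i := by
  rw [harmonicOpinion, extendZero_follower,
    if_neg fun h => i.2 (Finset.mem_union_right _ h), zero_add]

open scoped Classical in
theorem sum_harmonicOpinion (hG : G.Connected) (hS : (S0 ∪ S1).Nonempty) {i : V}
    (hi : i ∉ S0 ∪ S1) :
    ∑ j ∈ G.neighborFinset i, (harmonicOpinion G S0 S1 i - harmonicOpinion G S0 S1 j) = 0 := by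
  have hL := posDef_followerLaplacian hG hS
  have h := followerLaplacian_mulVec (G := G)
    ((followerLaplacian G S0 S1)⁻¹ *ᵥ oneLeaderCount G S0 S1) ⟨i, hi⟩
  rw [mulVec_inv_mulVec hL] at h
  have h1 : ∑ j ∈ G.neighborFinset i, (if j ∈ S1 then (1 : ℝ) else 0) =
      oneLeaderCount G S0 S1 ⟨i, hi⟩ := by
    rw [← Finset.sum_filter, Finset.sum_const, nsmul_eq_mul, mul_one, oneLeaderCount]
    congr 2
    ext j
    simp [and_comm]
  have hi1 : i ∉ S1 := fun h => hi (Finset.mem_union_right _ h)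
  simp only [harmonicOpinion, if_neg hi1, zero_add]
  simp only [sub_add_eq_sub_sub, Finset.sum_sub_distrib] at h ⊢
  linarith

theorem equilibrium_eq_harmonicOpinion (hG : G.Connected) (hS : (S0 ∪ S1).Nonempty)
    (x0 : Follower S0 S1 → ℝ) : equilibrium G S0 S1 x0 = harmonicOpinion G S0 S1 :=
  (tendsto_opinion hG hS x0 (fun _ hi => harmonicOpinion_leader hi)
    fun _ hi => sum_harmonicOpinion hG hS hi).limUnder_eq

/-- The effect of a new edge to a 1-leader on the equilibrium opinions. -/
theorem equilibrium_sup_edge (hG : G.Connected) (x0 : Follower S0 S1 → ℝ)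
    {i : Follower S0 S1} {u : V} (hu : u ∈ S1) (hiu : ¬ G.Adj (i : V) u) :
    equilibrium (G ⊔ SimpleGraph.edge (i : V) u) S0 S1 x0 = fun k =>
      harmonicOpinion G S0 S1 k + (1 - harmonicOpinion G S0 S1 i) /
        (1 + greenColumn (followerLaplacian G S0 S1) i i) *
          extendZero (greenColumn (followerLaplacian G S0 S1) i) k := by
  classical
  have hu' : u ∈ S0 ∪ S1 := Finset.mem_union_right _ hu
  have hS : (S0 ∪ S1).Nonempty := ⟨u, hu'⟩
  have hL := posDef_followerLaplacian hG hS
  set g := greenColumn (followerLaplacian G S0 S1) i with hg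
  have hr : 0 < g i := greenColumn_self_pos hL i
  set c := (1 - harmonicOpinion G S0 S1 i) / (1 + g i) with hc
  have hcr : c * (1 + g i) = 1 - harmonicOpinion G S0 S1 i := by
    rw [hc]
    field_simp
  have hne : (i : V) ≠ u := fun h => i.2 (h ▸ hu')
  -- It suffices that the proposed opinions have the leaders' values and are harmonic at followers
  -- in the enlarged graph. Over the old neighbours the defect is c at i and 0 at other followers;
  -- the new neighbour contributes x_i + c·g_i - 1, and c is chosen to cancel.
  refine (tendsto_opinion (hG.mono le_sup_left) hS x0 (fun k hk => ?_) fun k hk => ?_).limUnder_eq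
  · rw [extendZero_leader _ hk, harmonicOpinion_leader hk, mul_zero, add_zero]
  · have hsum : ∑ j ∈ G.neighborFinset k,
        (harmonicOpinion G S0 S1 k + c * extendZero g k -
          (harmonicOpinion G S0 S1 j + c * extendZero g j)) =
        if (⟨k, hk⟩ : Follower S0 S1) = i then c else 0 := by
      have h1 := followerLaplacian_mulVec (G := G) g ⟨k, hk⟩
      rw [mulVec_greenColumn hL, Pi.single_apply] at h1
      rw [Finset.sum_congr rfl (g := fun j =>
        (harmonicOpinion G S0 S1 k - harmonicOpinion G S0 S1 j) +
          c * (extendZero g k - extendZero g j)) fun j _ => by ring,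
        Finset.sum_add_distrib, sum_harmonicOpinion hG hS hk, ← Finset.mul_sum, ← h1]
      split_ifs <;> simp
    by_cases hki : k = i
    · subst hki
      have hN : ∀ _ : Fintype ((G ⊔ SimpleGraph.edge (i : V) u).neighborSet i),
          (G ⊔ SimpleGraph.edge (i : V) u).neighborFinset i = insert u (G.neighborFinset i) := by
        intro _
        ext j
        simp only [SimpleGraph.mem_neighborFinset, SimpleGraph.sup_adj, SimpleGraph.edge_adj,
          Finset.mem_insert]
        constructor
        · rintro (h | ⟨⟨-, h⟩ | ⟨h, -⟩, -⟩)
          · exact Or.inr h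
          · exact Or.inl h
          · exact absurd h hne
        · rintro (rfl | h)
          · exact Or.inr ⟨Or.inl ⟨trivial, rfl⟩, hne⟩
          · exact Or.inl h
      rw [hN, Finset.sum_insert (by simpa using hiu), hsum, if_pos rfl,
        extendZero_leader _ hu', harmonicOpinion_leader hu', if_pos hu, extendZero_follower]
      linarith
    · have hN : ∀ _ : Fintype ((G ⊔ SimpleGraph.edge (i : V) u).neighborSet k),
          (G ⊔ SimpleGraph.edge (i : V) u).neighborFinset k = G.neighborFinset k := by
        intro _
        ext j
        simp only [SimpleGraph.mem_neighborFinset, SimpleGraph.sup_adj, SimpleGraph.edge_adj]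
        refine or_iff_left ?_
        rintro ⟨⟨h, -⟩ | ⟨h, -⟩, -⟩
        · exact hki h
        · exact hk (h ▸ hu')
      rw [hN, hsum, if_neg fun h => hki (congrArg Subtype.val h)]

theorem opinionGain_eq (hG : G.Connected) (x0 : Follower S0 S1 → ℝ)
    {e : Follower S0 S1 × V} (hu : e.2 ∈ S1) (hadj : ¬ G.Adj (e.1 : V) e.2) :
    opinionGain G S0 S1 x0 e =
      ((followerLaplacian G S0 S1)⁻¹ *ᵥ fun _ => 1) e.1 *
        (1 - ((followerLaplacian G S0 S1)⁻¹ *ᵥ oneLeaderCount G S0 S1) e.1) /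
        (1 + greenColumn (followerLaplacian G S0 S1) e.1 e.1) := by
  have hS : (S0 ∪ S1).Nonempty := ⟨e.2, Finset.mem_union_right _ hu⟩
  have hL := posDef_followerLaplacian hG hS
  rw [opinionGain, overallOpinion, overallOpinion, ← Finset.sum_sub_distrib,
    equilibrium_sup_edge hG x0 hu hadj, equilibrium_eq_harmonicOpinion hG hS x0]
  simp only [add_sub_cancel_left, extendZero_follower, ← Finset.mul_sum]
  rw [inv_mulVec_apply hL, harmonicOpinion_follower, dotProduct]
  simp only [one_mul]
  ring

end Equilibrium

/-! ### Error bounds -/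

/-- With d = w - z, w² - z² = 2zd + d², and Young's inequality gives |2zd| ≤ cz² + d²/c. -/
theorem abs_sum_sq_sub_sum_sq_le {κ : Type*} [Fintype κ] (w z : κ → ℝ) {c : ℝ} (hc : 0 < c) :
    |∑ i, w i ^ 2 - ∑ i, z i ^ 2| ≤ c * ∑ i, z i ^ 2 + (c⁻¹ + 1) * ∑ i, (w i - z i) ^ 2 := by
  rw [← Finset.sum_sub_distrib, Finset.mul_sum, Finset.mul_sum, ← Finset.sum_add_distrib]
  refine (Finset.abs_sum_le_sum_abs _ _).trans (Finset.sum_le_sum fun i _ => ?_)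
  set d := w i - z i with hd
  have hw : w i = z i + d := by rw [hd]; ring
  have h1 : 0 ≤ c⁻¹ * (c * z i - d) ^ 2 := by positivity
  have h2 : 0 ≤ c⁻¹ * (c * z i + d) ^ 2 := by positivity
  have e1 : c⁻¹ * (c * z i - d) ^ 2 = c * z i ^ 2 - 2 * z i * d + c⁻¹ * d ^ 2 := by
    field_simp
    ring
  have e2 : c⁻¹ * (c * z i + d) ^ 2 = c * z i ^ 2 + 2 * z i * d + c⁻¹ * d ^ 2 := by
    field_simp
    ring
  rw [e1] at h1
  rw [e2] at h2
  rw [hw, abs_le]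
  constructor <;> nlinarith [sq_nonneg d]

/-- To first order the errors add up to ε/18 + ε/9 + ε/6 = ε/3; the slack up to ε absorbs the
quadratic terms when ε < 1/2. -/
theorem quotient_accuracy {ε h h' q q' r r' : ℝ} (hε0 : 0 < ε) (hε : ε < 1 / 2) (hh : 0 ≤ h)
    (hq : 0 ≤ 1 - q) (hr : 0 ≤ r) (hh' : |h' - h| ≤ ε / 18 * h)
    (hq' : |q' - q| ≤ ε / 9 * (1 - q)) (hr' : |r' - r| ≤ ε / 6 * r) :
    (1 - ε) * (h * (1 - q) / (1 + r)) ≤ h' * (1 - q') / (1 + r') ∧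
      h' * (1 - q') / (1 + r') ≤ (1 + ε) * (h * (1 - q) / (1 + r)) := by
  obtain ⟨h1, h2⟩ := abs_le.1 hh'
  obtain ⟨q1, q2⟩ := abs_le.1 hq'
  obtain ⟨r1, r2⟩ := abs_le.1 hr'
  have hM : 0 ≤ h * (1 - q) := mul_nonneg hh hq
  have hnum1 : (1 - ε / 18) * h * ((1 - ε / 9) * (1 - q)) ≤ h' * (1 - q') :=
    mul_le_mul (by linarith) (by linarith) (mul_nonneg (by linarith) hq)
      ((mul_nonneg (by linarith : (0 : ℝ) ≤ 1 - ε / 18) hh).trans (by linarith))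
  have hq0 : 0 ≤ 1 - q' :=
    (mul_nonneg (by linarith : (0 : ℝ) ≤ 1 - ε / 9) hq).trans (by linarith)
  have hnum2 : h' * (1 - q') ≤ (1 + ε / 18) * h * ((1 + ε / 9) * (1 - q)) :=
    mul_le_mul (by linarith) (by linarith) hq0 (mul_nonneg (by linarith) hh)
  have hd1 : (1 - ε / 6) * (1 + r) ≤ 1 + r' := by linarith
  have hd2 : 1 + r' ≤ (1 + ε / 6) * (1 + r) := by linarith
  have hpos : 0 < 1 + r := by linarith
  have hpos' : 0 < 1 + r' := (mul_pos (by linarith : (0 : ℝ) < 1 - ε / 6) hpos).trans_le hd1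
  have hD : 0 ≤ h * (1 - q) / (1 + r) := div_nonneg hM hpos.le
  have hDM : h * (1 - q) / (1 + r) * (1 + r) = h * (1 - q) := div_mul_cancel₀ _ hpos.ne'
  set D := h * (1 - q) / (1 + r)
  set M := h * (1 - q) with hMdef
  constructor
  · rw [le_div_iff₀ hpos']
    calc (1 - ε) * D * (1 + r') ≤ (1 - ε) * D * ((1 + ε / 6) * (1 + r)) :=
          mul_le_mul_of_nonneg_left hd2 (mul_nonneg (by linarith) hD)
      _ = (1 - ε) * (1 + ε / 6) * M := by rw [← hDM]; ring
      _ ≤ (1 - ε / 18) * (1 - ε / 9) * M :=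
          mul_le_mul_of_nonneg_right (by nlinarith) hM
      _ = (1 - ε / 18) * h * ((1 - ε / 9) * (1 - q)) := by rw [hMdef]; ring
      _ ≤ _ := hnum1
  · rw [div_le_iff₀ hpos']
    calc h' * (1 - q') ≤ (1 + ε / 18) * h * ((1 + ε / 9) * (1 - q)) := hnum2
      _ = (1 + ε / 18) * (1 + ε / 9) * M := by rw [hMdef]; ring
      _ ≤ (1 + ε) * (1 - ε / 6) * M := mul_le_mul_of_nonneg_right (by nlinarith) hM
      _ = (1 + ε) * D * ((1 - ε / 6) * (1 + r)) := by rw [← hDM]; ring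
      _ ≤ _ := mul_le_mul_of_nonneg_left hd1 (mul_nonneg (by linarith) hD)

/-! ### Numerical estimates for the tolerances and the number of rows -/

section Parameters

variable {n : ℕ} {ε η : ℝ}

/-- For n ≥ 4 the radicand is at least 90 > 81. The 9 is the source of the tolerances ε/18 and ε/9.
-/
theorem nine_le_sqrt (hn : 4 ≤ n) : 9 ≤ √(6 * ((n : ℝ) ^ 2 - 1)) := by
  have hn' : (4 : ℝ) ≤ n := by exact_mod_cast hn
  exact Real.le_sqrt_of_sq_le (by nlinarith)

theorem delta1_pos (hn : 4 ≤ n) (hε : 0 < ε) : 0 < delta1 n ε := by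
  have := nine_le_sqrt hn
  have hn' : (0 : ℝ) < n := by exact_mod_cast (by omega : 0 < n)
  unfold delta1
  positivity

theorem delta1_mul_le (hn : 4 ≤ n) (hε : 0 < ε) : delta1 n ε * (n : ℝ) ^ 2 ≤ ε / 18 := by
  have hK := nine_le_sqrt hn
  have hn' : (0 : ℝ) < n := by exact_mod_cast (by omega : 0 < n)
  unfold delta1
  rw [div_mul_eq_mul_div, div_le_div_iff₀ (by positivity) (by norm_num)]
  have : 0 ≤ ε * (n : ℝ) ^ 2 * (√(6 * ((n : ℝ) ^ 2 - 1)) - 9) :=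
    mul_nonneg (by positivity) (by linarith)
  linarith

theorem delta2_pos (hn : 4 ≤ n) (hε : 0 < ε) (hη : η < 1) : 0 < delta2 n ε η := by
  have := nine_le_sqrt hn
  have hn' : (0 : ℝ) < n := by exact_mod_cast (by omega : 0 < n)
  have : 0 < 1 - η := by linarith
  unfold delta2
  positivity

theorem delta2_mul_le (hn : 4 ≤ n) (hε : 0 < ε) (hη : η < 1) :
    delta2 n ε η * (n : ℝ) ^ 2 ≤ ε / 9 * (1 - η) := by
  have hK := nine_le_sqrt hn
  have hn' : (0 : ℝ) < n := by exact_mod_cast (by omega : 0 < n)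
  have hη' : 0 < 1 - η := by linarith
  unfold delta2
  rw [div_mul_eq_mul_div, div_le_iff₀ (by positivity)]
  have : 0 ≤ ε * (1 - η) * (n : ℝ) ^ 2 * (√(6 * ((n : ℝ) ^ 2 - 1)) - 9) :=
    mul_nonneg (by positivity) (by linarith)
  linarith

theorem delta3_pos (hn : 4 ≤ n) (hε : 0 < ε) (hε' : ε < 1 / 2) : 0 < delta3 n ε := by
  have hn' : (4 : ℝ) ≤ n := by exact_mod_cast hn
  have h1 : 0 < (n : ℝ) ^ 2 - 1 := by nlinarith
  have h2 : 0 < 1 - ε / 12 := by linarith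
  have h3 : 0 < (n : ℝ) := by linarith
  unfold delta3
  positivity

theorem delta3_mul_le (hn : 4 ≤ n) (hε : 0 < ε) : delta3 n ε * n ≤ ε / 72 := by
  have hn' : (4 : ℝ) ≤ n := by exact_mod_cast hn
  have h1 : 15 ≤ (n : ℝ) ^ 2 - 1 := by nlinarith
  have hs : √(6 * (1 - ε / 12) / ((1 + ε / 12) * ((n : ℝ) ^ 2 - 1))) ≤ 1 := by
    rw [Real.sqrt_le_one, div_le_one (by positivity)]
    nlinarith
  unfold delta3
  calc ε / (72 * (n : ℝ) ^ 2) * √(6 * (1 - ε / 12) / ((1 + ε / 12) * ((n : ℝ) ^ 2 - 1))) * n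
      ≤ ε / (72 * (n : ℝ) ^ 2) * 1 * n := by gcongr
    _ = ε / 72 * (1 / n) := by field_simp
    _ ≤ ε / 72 * 1 := by
        gcongr
        rw [div_le_one (by linarith)]
        linarith
    _ = ε / 72 := mul_one _

theorem numRows_pos {N : ℕ} (hN : 2 ≤ N) (hε : 0 < ε) : 0 < numRows N ε := by
  have h : 0 < Real.log N := Real.log_pos (by exact_mod_cast hN)
  exact Nat.ceil_pos.2 (by positivity)

/-- The choice of t makes the exponential at most N⁻⁴, and 2/N³ ≤ 1/(2N) because N ≥ 2. -/
theorem projection_failure_le {N : ℕ} (hN : 2 ≤ N) (hε : 0 < ε) :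
    (N : ℝ) * (2 * Real.exp (-(numRows N ε * (ε / 12) ^ 2 / 6))) ≤ 1 / (2 * N) := by
  have hN' : (2 : ℝ) ≤ N := by exact_mod_cast hN
  have hN0 : (0 : ℝ) < N := by linarith
  have ht : 24 * Real.log N / (ε / 12) ^ 2 ≤ numRows N ε := Nat.le_ceil _
  rw [div_le_iff₀ (by positivity)] at ht
  have he : Real.exp (-(numRows N ε * (ε / 12) ^ 2 / 6)) ≤ ((N : ℝ) ^ 4)⁻¹ := by
    rw [← Real.exp_log (pow_pos hN0 4), ← Real.exp_neg, Real.log_pow]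
    refine Real.exp_le_exp.2 ?_
    push_cast
    linarith
  calc (N : ℝ) * (2 * Real.exp (-(numRows N ε * (ε / 12) ^ 2 / 6)))
      ≤ N * (2 * ((N : ℝ) ^ 4)⁻¹) := by gcongr
    _ = 2 / (N : ℝ) ^ 3 := by field_simp
    _ ≤ 1 / (2 * N) := by
        rw [div_le_div_iff₀ (by positivity) (by positivity)]
        nlinarith [mul_nonneg hN0.le (by nlinarith : (0 : ℝ) ≤ (N : ℝ) ^ 2 - 4)]

end Parameters

/-! ### Size bounds for the exact solutions and entrywise solver errors -/

section Graph

variable {V : Type*} [Fintype V] [DecidableEq V] {G : SimpleGraph V} {S0 S1 : Finset V}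

theorem four_le_card (hdisj : Disjoint S0 S1) (hS0 : S0.Nonempty) (hS1 : S1.Nonempty)
    (hF : 2 ≤ Fintype.card (Follower S0 S1)) : 4 ≤ Fintype.card V := by
  have h : Fintype.card (Follower S0 S1) = Fintype.card V - (S0.card + S1.card) := by
    rw [Fintype.card_subtype_compl (fun v => v ∈ S0 ∪ S1), Fintype.card_coe,
      Finset.card_union_of_disjoint hdisj]
  have h0 := hS0.card_pos
  have h1 := hS1.card_pos
  omega

theorem card_follower_le : (Fintype.card (Follower S0 S1) : ℝ) ≤ Fintype.card V :=
  Nat.cast_le.2 (Fintype.card_subtype_le _)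

theorem card_edgeSet_le (o : EdgeOrientation (followerGraph G S0 S1))
    [Fintype (followerGraph G S0 S1).edgeSet] :
    (Fintype.card (followerGraph G S0 S1).edgeSet : ℝ) ≤ (Fintype.card V : ℝ) ^ 2 := by
  have h := Fintype.card_le_of_injective (fun e => (o.head e, o.tail e)) fun e e' h => by
    simp only [Prod.mk.injEq] at h
    exact Subtype.ext (by rw [o.ends, o.ends, h.1, h.2])
  rw [Fintype.card_prod, ← sq] at h
  calc (Fintype.card (followerGraph G S0 S1).edgeSet : ℝ)
      ≤ (Fintype.card (Follower S0 S1) : ℝ) ^ 2 := by exact_mod_cast h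
    _ ≤ _ := pow_le_pow_left₀ (Nat.cast_nonneg _) card_follower_le 2

theorem greenColumn_self_le (hG : G.Connected) (hS : (S0 ∪ S1).Nonempty)
    (j : Follower S0 S1) :
    greenColumn (followerLaplacian G S0 S1) j j ≤ Fintype.card V := by
  have hL := posDef_followerLaplacian hG hS
  have h := sq_le_card_mul_followerLaplacian hG hS (greenColumn (followerLaplacian G S0 S1) j) j
  rw [dotProduct_mulVec_greenColumn hL, sq] at h
  exact le_of_mul_le_mul_right h (greenColumn_self_pos hL j)

theorem one_le_greenColumn_self_mul_card (hG : G.Connected) (hS : (S0 ∪ S1).Nonempty)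
    (j : Follower S0 S1) :
    1 ≤ greenColumn (followerLaplacian G S0 S1) j j * Fintype.card V := by
  have hL := posDef_followerLaplacian hG hS
  exact (one_le_greenColumn_mul hL j).trans (mul_le_mul_of_nonneg_left
    (followerLaplacian_apply_self_le j) (greenColumn_self_pos hL j).le)

/-- The inverse of L preserves nonnegativity, and 1 - e_j ≥ 0. This turns errors proportional to r
into errors relative to h_j. -/
theorem greenColumn_self_le_inv_mulVec_one (hG : G.Connected) (hS : (S0 ∪ S1).Nonempty)
    (j : Follower S0 S1) :
    greenColumn (followerLaplacian G S0 S1) j j ≤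
      ((followerLaplacian G S0 S1)⁻¹ *ᵥ fun _ => 1) j := by
  have h := inv_mulVec_nonneg hG hS (y := (fun _ => 1) - Pi.single j 1) (fun i => by
    rw [Pi.sub_apply, Pi.single_apply]
    split_ifs <;> norm_num) j
  rw [Matrix.mulVec_sub, Pi.sub_apply, sub_nonneg] at h
  exact h

/-- The energy is s = Σ h_i, while h_i² ≤ ns for each i; Cauchy–Schwarz then gives s² ≤ n³s. -/
theorem energy_inv_mulVec_one_le (hG : G.Connected) (hS : (S0 ∪ S1).Nonempty)
    :
    ((followerLaplacian G S0 S1)⁻¹ *ᵥ fun _ => 1) ⬝ᵥ (followerLaplacian G S0 S1 *ᵥ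
      ((followerLaplacian G S0 S1)⁻¹ *ᵥ fun _ => 1)) ≤ (Fintype.card V : ℝ) ^ 3 := by
  have hL := posDef_followerLaplacian hG hS
  set h := (followerLaplacian G S0 S1)⁻¹ *ᵥ fun _ => (1 : ℝ) with hh
  set s := h ⬝ᵥ (followerLaplacian G S0 S1 *ᵥ h) with hs
  have hsum : s = ∑ i, h i := by
    rw [hs, hh, mulVec_inv_mulVec hL, dotProduct]
    simp
  have hs0 : 0 ≤ s := energy_nonneg hL h
  have hN := card_follower_le (S0 := S0) (S1 := S1)
  have h1 : s ^ 2 ≤ (Fintype.card V : ℝ) ^ 3 * s := by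
    calc s ^ 2 ≤ Fintype.card (Follower S0 S1) * ∑ i, h i ^ 2 := by
          rw [hsum]
          exact sq_sum_le_card_mul_sum_sq
      _ ≤ Fintype.card (Follower S0 S1) * ∑ _i : Follower S0 S1, Fintype.card V * s := by
          gcongr with i
          exact sq_le_card_mul_followerLaplacian hG hS h i
      _ = (Fintype.card (Follower S0 S1) : ℝ) ^ 2 * (Fintype.card V * s) := by
          rw [Finset.sum_const, Finset.card_univ, nsmul_eq_mul]
          ring
      _ ≤ (Fintype.card V : ℝ) ^ 2 * (Fintype.card V * s) := by gcongr
      _ = _ := by ring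
  rcases hs0.eq_or_lt with h0 | h0
  · rw [← h0]
    positivity
  · rw [sq] at h1
    exact le_of_mul_le_mul_right h1 h0

/-- L sends 1 - L⁻¹b to the number of 0-leader neighbours, which is nonnegative; the minimum
principle applies. -/
theorem inv_mulVec_oneLeaderCount_le_one (hG : G.Connected) (hS : (S0 ∪ S1).Nonempty)
    (i : Follower S0 S1) :
    ((followerLaplacian G S0 S1)⁻¹ *ᵥ oneLeaderCount G S0 S1) i ≤ 1 := by
  have hL := posDef_followerLaplacian hG hS
  have h := nonneg_of_mulVec_nonneg hL
    (fun i j h => followerLaplacian_apply_nonpos h)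
    (v := (fun _ => 1) - (followerLaplacian G S0 S1)⁻¹ *ᵥ oneLeaderCount G S0 S1) (fun i => by
      rw [Matrix.mulVec_sub, mulVec_inv_mulVec hL, Pi.sub_apply, leaderCount_eq_mulVec_one,
        sub_nonneg]
      exact oneLeaderCount_le_leaderCount i) i
  simpa using h

theorem energy_inv_mulVec_oneLeaderCount_le (hG : G.Connected) (hS : (S0 ∪ S1).Nonempty)
    :
    ((followerLaplacian G S0 S1)⁻¹ *ᵥ oneLeaderCount G S0 S1) ⬝ᵥ (followerLaplacian G S0 S1 *ᵥ
      ((followerLaplacian G S0 S1)⁻¹ *ᵥ oneLeaderCount G S0 S1)) ≤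
      (Fintype.card V : ℝ) ^ 2 := by
  have hL := posDef_followerLaplacian hG hS
  rw [mulVec_inv_mulVec hL]
  calc _ ≤ ∑ _i : Follower S0 S1, 1 * (Fintype.card V : ℝ) :=
        Finset.sum_le_sum fun i _ => mul_le_mul (inv_mulVec_oneLeaderCount_le_one hG hS i)
          (oneLeaderCount_le_card i) (oneLeaderCount_nonneg i) zero_le_one
    _ = Fintype.card (Follower S0 S1) * (Fintype.card V : ℝ) := by
        rw [Finset.sum_const, Finset.card_univ, nsmul_eq_mul, one_mul]
    _ ≤ Fintype.card V * (Fintype.card V : ℝ) :=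
        mul_le_mul_of_nonneg_right card_follower_le (Nat.cast_nonneg _)
    _ = _ := (sq _).symm

theorem abs_sub_inv_mulVec_one_le (hG : G.Connected) (hS : (S0 ∪ S1).Nonempty)
    {ε : ℝ} (hn : 4 ≤ Fintype.card V) (hε : 0 < ε)
    {h : Follower S0 S1 → ℝ}
    (hh : energyNorm (followerLaplacian G S0 S1)
        (h - (followerLaplacian G S0 S1)⁻¹ *ᵥ fun _ => 1) ≤
      delta1 (Fintype.card V) ε *
        energyNorm (followerLaplacian G S0 S1) ((followerLaplacian G S0 S1)⁻¹ *ᵥ fun _ => 1))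
    (j : Follower S0 S1) :
    |h j - ((followerLaplacian G S0 S1)⁻¹ *ᵥ fun _ => 1) j| ≤
      ε / 18 * ((followerLaplacian G S0 S1)⁻¹ *ᵥ fun _ => 1) j := by
  have hL := posDef_followerLaplacian hG hS
  have h1 := sq_sub_apply_le hL hh j
  have hE := energy_inv_mulVec_one_le hG hS
  have hr := greenColumn_self_pos hL j
  have hrh := greenColumn_self_le_inv_mulVec_one hG hS j
  have hrn := one_le_greenColumn_self_mul_card hG hS j
  have hδ := delta1_mul_le hn hε
  have hδ0 := delta1_pos hn hε
  set z := (followerLaplacian G S0 S1)⁻¹ *ᵥ fun _ => (1 : ℝ)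
  set r := greenColumn (followerLaplacian G S0 S1) j j
  set n : ℝ := (Fintype.card V : ℝ)
  have hn0 : 0 ≤ n := Nat.cast_nonneg _
  have hz : 0 < z j := hr.trans_le hrh
  refine abs_le_of_sq_le_sq ?_ (by positivity)
  calc (h j - z j) ^ 2 ≤ r * (delta1 (Fintype.card V) ε ^ 2 * (z ⬝ᵥ _)) := h1
    _ ≤ r * (delta1 (Fintype.card V) ε ^ 2 * n ^ 3) := by gcongr
    -- The factor rn ≥ 1 supplies a second r, so that r ≤ h_j can be used squared.
    _ ≤ r * (delta1 (Fintype.card V) ε ^ 2 * n ^ 3) * (r * n) :=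
        le_mul_of_one_le_right (by positivity) hrn
    _ = (delta1 (Fintype.card V) ε * n ^ 2) ^ 2 * r ^ 2 := by ring
    _ ≤ (ε / 18) ^ 2 * z j ^ 2 := by gcongr
    _ = (ε / 18 * z j) ^ 2 := by ring

theorem abs_sub_inv_mulVec_oneLeaderCount_le (hG : G.Connected) (hS : (S0 ∪ S1).Nonempty)
    {ε η : ℝ} (hn : 4 ≤ Fintype.card V) (hε : 0 < ε)
    (hη : η < 1) {q : Follower S0 S1 → ℝ}
    (hq : energyNorm (followerLaplacian G S0 S1)
        (q - (followerLaplacian G S0 S1)⁻¹ *ᵥ oneLeaderCount G S0 S1) ≤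
      delta2 (Fintype.card V) ε η * energyNorm (followerLaplacian G S0 S1)
        ((followerLaplacian G S0 S1)⁻¹ *ᵥ oneLeaderCount G S0 S1))
    {j : Follower S0 S1}
    (hj : ((followerLaplacian G S0 S1)⁻¹ *ᵥ oneLeaderCount G S0 S1) j ≤ η) :
    |q j - ((followerLaplacian G S0 S1)⁻¹ *ᵥ oneLeaderCount G S0 S1) j| ≤
      ε / 9 * (1 - ((followerLaplacian G S0 S1)⁻¹ *ᵥ oneLeaderCount G S0 S1) j) := by
  have hL := posDef_followerLaplacian hG hS
  have h1 := sq_sub_apply_le hL hq j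
  have hE := energy_inv_mulVec_oneLeaderCount_le hG hS
  have hr := greenColumn_self_pos hL j
  have hrn := greenColumn_self_le hG hS j
  have hδ := delta2_mul_le hn hε hη
  have hδ0 := delta2_pos hn hε hη
  set z := (followerLaplacian G S0 S1)⁻¹ *ᵥ oneLeaderCount G S0 S1
  set r := greenColumn (followerLaplacian G S0 S1) j j
  set n : ℝ := (Fintype.card V : ℝ)
  have hn1 : 1 ≤ n := by
    have : (4 : ℝ) ≤ n := Nat.ofNat_le_cast.2 hn
    linarith
  have hη' : 0 < 1 - η := by linarith
  have hE0 := energy_nonneg hL z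
  -- The threshold enters here: an absolute error of order 1 - η is a relative error for 1 - z_j ≥ 1
  -- - η.
  refine (abs_le_of_sq_le_sq ?_ (by positivity)).trans
    (mul_le_mul_of_nonneg_left (by linarith : 1 - η ≤ 1 - z j) (by positivity))
  calc (q j - z j) ^ 2 ≤ r * (delta2 (Fintype.card V) ε η ^ 2 * (z ⬝ᵥ _)) := h1
    _ ≤ n * (delta2 (Fintype.card V) ε η ^ 2 * n ^ 2) := by gcongr
    _ ≤ n * (delta2 (Fintype.card V) ε η ^ 2 * n ^ 2) * n :=
        le_mul_of_one_le_right (by positivity) hn1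
    _ = (delta2 (Fintype.card V) ε η * n ^ 2) ^ 2 := by ring
    _ ≤ (ε / 9 * (1 - η)) ^ 2 := by gcongr

theorem abs_sum_sq_sub_projection_le (hG : G.Connected) (hS : (S0 ∪ S1).Nonempty)
    {κ : Type*} [Fintype κ] {ε : ℝ}
    (hn : 4 ≤ Fintype.card V) (hε : 0 < ε) (hε' : ε < 1 / 2)
    {C : Matrix κ (Follower S0 S1) ℝ}
    (hC : ∀ v, ∑ k, (C *ᵥ v) k ^ 2 ≤ v ⬝ᵥ (followerLaplacian G S0 S1 *ᵥ v))
    {t : ℕ} {P : Matrix (Fin t) κ ℝ}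
    (hP : ∑ i, ∑ k, P i k ^ 2 ≤ (Fintype.card V : ℝ) ^ 2) (j : Follower S0 S1)
    (hJ : |∑ i, (P *ᵥ (C *ᵥ greenColumn (followerLaplacian G S0 S1) j)) i ^ 2 -
        ∑ k, (C *ᵥ greenColumn (followerLaplacian G S0 S1) j) k ^ 2| ≤
      ε / 12 * ∑ k, (C *ᵥ greenColumn (followerLaplacian G S0 S1) j) k ^ 2)
    {X : Fin t → Follower S0 S1 → ℝ}
    (hX : ∀ i, energyNorm (followerLaplacian G S0 S1)
        (X i - (followerLaplacian G S0 S1)⁻¹ *ᵥ (P * C) i) ≤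
      delta3 (Fintype.card V) ε *
        energyNorm (followerLaplacian G S0 S1) ((followerLaplacian G S0 S1)⁻¹ *ᵥ (P * C) i)) :
    |∑ i, X i j ^ 2 - ∑ i, (P *ᵥ (C *ᵥ greenColumn (followerLaplacian G S0 S1) j)) i ^ 2| ≤
      ε / 24 * greenColumn (followerLaplacian G S0 S1) j j := by
  have hL := posDef_followerLaplacian hG hS
  have h1 := sum_sq_sub_projection_le hL hC P hX j
  have hr := greenColumn_self_pos hL j
  have hCr := hC (greenColumn (followerLaplacian G S0 S1) j)
  rw [dotProduct_mulVec_greenColumn hL] at hCr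
  have hδ := delta3_mul_le hn hε
  have hδ0 := delta3_pos hn hε hε'
  have h2 := abs_sum_sq_sub_sum_sq_le (fun i => X i j)
    (fun i => (P *ᵥ (C *ᵥ greenColumn (followerLaplacian G S0 S1) j)) i)
    (c := ε / 72) (by positivity)
  set r := greenColumn (followerLaplacian G S0 S1) j j
  set n : ℝ := (Fintype.card V : ℝ)
  have hn0 : 0 ≤ n := Nat.cast_nonneg _
  have hd : ∑ i, (X i j - (P *ᵥ (C *ᵥ greenColumn (followerLaplacian G S0 S1) j)) i) ^ 2 ≤
      r * (ε / 72) ^ 2 := by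
    refine h1.trans ?_
    calc r * (delta3 (Fintype.card V) ε ^ 2 * ∑ i, ∑ k, P i k ^ 2)
        ≤ r * (delta3 (Fintype.card V) ε ^ 2 * n ^ 2) := by gcongr
      _ = r * (delta3 (Fintype.card V) ε * n) ^ 2 := by ring
      _ ≤ _ := by gcongr
  -- Here 25/24 bounds 1 + ε/12 for ε < 1/2.
  have hz : ∑ i, (P *ᵥ (C *ᵥ greenColumn (followerLaplacian G S0 S1) j)) i ^ 2 ≤
      25 / 24 * r := by
    have h3 := (abs_le.1 hJ).2
    have h4 : ε / 12 * ∑ k, (C *ᵥ greenColumn (followerLaplacian G S0 S1) j) k ^ 2 ≤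
        1 / 24 * r := mul_le_mul (by linarith) hCr
          (Finset.sum_nonneg fun _ _ => sq_nonneg _) (by norm_num)
    linarith
  refine h2.trans ?_
  calc _ ≤ ε / 72 * (25 / 24 * r) + ((ε / 72)⁻¹ + 1) * (r * (ε / 72) ^ 2) := by gcongr
    _ = r * (ε / 72 * (25 / 24 + 1 + ε / 72)) := by
        field_simp
        ring
    _ ≤ r * (ε / 72 * 3) := by
        gcongr
        linarith
    _ = ε / 24 * r := by ring

end Graph

/-! ### The algorithm -/

section Algorithm

variable {V : Type*} [Fintype V] [DecidableEq V] {G : SimpleGraph V} {S0 S1 : Finset V}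

/-- The random projection `M` preserves the lengths of the columns of `C L⁻¹` up to `1 ± ε/12`,
and has bounded Frobenius norm. -/
def IsGoodProjection {κ : Type*} [Fintype κ] (G : SimpleGraph V) (S0 S1 : Finset V) (ε : ℝ)
    (C : Matrix κ (Follower S0 S1) ℝ) {t : ℕ} (M : Matrix (Fin t) κ ℝ) : Prop :=
  (∀ j, |∑ i, (M *ᵥ (C *ᵥ greenColumn (followerLaplacian G S0 S1) j)) i ^ 2 -
      ∑ k, (C *ᵥ greenColumn (followerLaplacian G S0 S1) j) k ^ 2| ≤
    ε / 12 * ∑ k, (C *ᵥ greenColumn (followerLaplacian G S0 S1) j) k ^ 2) ∧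
  ∑ i, ∑ k, M i k ^ 2 = Fintype.card κ

/-- `x` solves `L_F x = y` with relative error `δ`. -/
def IsGoodSolution (G : SimpleGraph V) (S0 S1 : Finset V) (y : Follower S0 S1 → ℝ) (δ : ℝ)
    (x : Follower S0 S1 → ℝ) : Prop :=
  energyNorm (followerLaplacian G S0 S1) (x - (followerLaplacian G S0 S1)⁻¹ *ᵥ y) ≤
    δ * energyNorm (followerLaplacian G S0 S1) ((followerLaplacian G S0 S1)⁻¹ *ᵥ y)

/-- The returned value is accurate as soon as the projections and all solver calls are good. -/
theorem returned_value_accuracy (hG : G.Connected) (hn : 4 ≤ Fintype.card V)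
    (x0 : Follower S0 S1 → ℝ) {ε η : ℝ} (hε0 : 0 < ε) (hε : ε < 1 / 2) (hη : η < 1)
    {e : Follower S0 S1 × V} (he : e.2 ∈ S1) (hadj : ¬ G.Adj (e.1 : V) e.2)
    (hle : equilibrium G S0 S1 x0 e.1 ≤ η) [Fintype (followerGraph G S0 S1).edgeSet]
    (o : EdgeOrientation (followerGraph G S0 S1)) {t : ℕ}
    {P : Matrix (Fin t) (followerGraph G S0 S1).edgeSet ℝ}
    {R : Matrix (Fin t) (Follower S0 S1) ℝ} {h q : Follower S0 S1 → ℝ}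
    {X Y : Fin t → Follower S0 S1 → ℝ}
    (hP : IsGoodProjection G S0 S1 ε (incidence o) P)
    (hR : IsGoodProjection G S0 S1 ε (sqrtLeaderMatrix G S0 S1) R)
    (hh : IsGoodSolution G S0 S1 (fun _ => 1) (delta1 (Fintype.card V) ε) h)
    (hq : IsGoodSolution G S0 S1 (oneLeaderCount G S0 S1) (delta2 (Fintype.card V) ε η) q)
    (hX : ∀ i, IsGoodSolution G S0 S1 ((P * incidence o) i) (delta3 (Fintype.card V) ε) (X i))
    (hY : ∀ i, IsGoodSolution G S0 S1 ((R * sqrtLeaderMatrix G S0 S1) i)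
      (delta3 (Fintype.card V) ε) (Y i)) :
    (1 - ε) * opinionGain G S0 S1 x0 e ≤
        h e.1 * (1 - q e.1) / (1 + ∑ i, X i e.1 ^ 2 + ∑ i, Y i e.1 ^ 2) ∧
      h e.1 * (1 - q e.1) / (1 + ∑ i, X i e.1 ^ 2 + ∑ i, Y i e.1 ^ 2) ≤
        (1 + ε) * opinionGain G S0 S1 x0 e := by
  have hS : (S0 ∪ S1).Nonempty := ⟨e.2, Finset.mem_union_right _ he⟩
  have hL := posDef_followerLaplacian hG hS
  rw [equilibrium_eq_harmonicOpinion hG hS, harmonicOpinion_follower] at hle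
  rw [opinionGain_eq hG x0 he hadj, add_assoc]
  set j := e.1
  have hr := greenColumn_self_pos hL j
  have hform := dotProduct_followerLaplacian_eq_add (G := G) o
  have hB : ∀ v, ∑ k, (incidence o *ᵥ v) k ^ 2 ≤ v ⬝ᵥ (followerLaplacian G S0 S1 *ᵥ v) :=
    fun v => hform v ▸ le_add_of_nonneg_right (Finset.sum_nonneg fun _ _ => sq_nonneg _)
  have hW : ∀ v, ∑ k, (sqrtLeaderMatrix G S0 S1 *ᵥ v) k ^ 2 ≤
      v ⬝ᵥ (followerLaplacian G S0 S1 *ᵥ v) :=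
    fun v => hform v ▸ le_add_of_nonneg_left (Finset.sum_nonneg fun _ _ => sq_nonneg _)
  have hn1 : (1 : ℝ) ≤ Fintype.card V := Nat.one_le_cast.2 (by omega)
  have hRn : (Fintype.card (Follower S0 S1) : ℝ) ≤ (Fintype.card V : ℝ) ^ 2 :=
    card_follower_le.trans (le_self_pow₀ hn1 two_ne_zero)
  have hXe := abs_sum_sq_sub_projection_le hG hS hn hε0 hε hB
    (hP.2.trans_le (card_edgeSet_le o)) j (hP.1 j) hX
  have hYe := abs_sum_sq_sub_projection_le hG hS hn hε0 hε hW (hR.2.trans_le hRn) j (hR.1 j) hY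
  have hPj := hP.1 j
  have hRj := hR.1 j
  have hsplit := hform (greenColumn (followerLaplacian G S0 S1) j)
  rw [dotProduct_mulVec_greenColumn hL] at hsplit
  refine quotient_accuracy hε0 hε
    (hr.le.trans (greenColumn_self_le_inv_mulVec_one hG hS j))
    (sub_nonneg.2 (inv_mulVec_oneLeaderCount_le_one hG hS j)) hr.le
    (abs_sub_inv_mulVec_one_le hG hS hn hε0 hh j)
    (abs_sub_inv_mulVec_oneLeaderCount_le hG hS hn hε0 hη hq hle) ?_
  -- The error in r adds up as ε/12 from the projections, whose two lengths sum to r, and ε/24 from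
  -- each family of solver calls.
  rw [abs_le] at hXe hYe hPj hRj ⊢
  rw [hsplit] at hXe hYe ⊢
  constructor <;> linarith

theorem isGoodProjection_failure_le {κ : Type*} [Fintype κ] [DecidableEq κ] {ε : ℝ}
    (hε0 : 0 < ε) (hε : ε < 1 / 2) (hF : 2 ≤ Fintype.card (Follower S0 S1))
    (C : Matrix κ (Follower S0 S1) ℝ) :
    (randomSignMatrix (numRows (Fintype.card (Follower S0 S1)) ε) κ).toOuterMeasure
      {M | IsGoodProjection G S0 S1 ε C M}ᶜ ≤
      ENNReal.ofReal (1 / (2 * Fintype.card (Follower S0 S1))) :=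
  (toOuterMeasure_randomSignMatrix_compl_le (α := ε / 12) (by positivity) (by linarith)
    (numRows_pos hF hε0)
    fun j => C *ᵥ greenColumn (followerLaplacian G S0 S1) j).trans
    (ENNReal.ofReal_le_ofReal (projection_failure_le hF hε0))

end Algorithm

end OpinionDynamics

theorem mainTheorem5 {V : Type*} [Fintype V] [DecidableEq V]
    (G : SimpleGraph V) (hG : G.Connected)
    (S0 S1 : Finset V) (hdisj : Disjoint S0 S1) (hS0 : S0.Nonempty) (hS1 : S1.Nonempty)
    (hF : 2 ≤ Fintype.card (Follower S0 S1))
    (x0 : Follower S0 S1 → ℝ) (hx0 : ∀ i, x0 i ∈ Set.Icc (0 : ℝ) 1)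
    (ε η : ℝ) (hε0 : 0 < ε) (hε : ε < 1 / 2) (hη0 : 1 / 2 < η) (hη : η < 1)
    (Q : Finset (Follower S0 S1 × V)) (hQ : IsCandidateSet G S0 S1 x0 η Q)
    (o : EdgeOrientation (followerGraph G S0 S1))
    (Solve : Solver (Follower S0 S1)) (p : ℝ) (hSolve : IsSDDSolver Solve p) :
    1 - 1 / (Fintype.card (Follower S0 S1) : ℝ)
        - (2 * (numRows (Fintype.card (Follower S0 S1)) ε : ℝ) + 2) * p
      ≤ prob (opinionComp G S0 S1 o Solve Q ε η)
          {Δ' | ∀ e : Q, (1 - ε) * opinionGain G S0 S1 x0 e ≤ Δ' e ∧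
            Δ' e ≤ (1 + ε) * opinionGain G S0 S1 x0 e} := by
  have hS : (S0 ∪ S1).Nonempty := hS0.mono Finset.subset_union_left
  have hn := four_le_card hdisj hS0 hS1 hF
  have hgood := fun (y : Follower S0 S1 → ℝ) (δ : ℝ) (hδ : 0 < δ) =>
    hSolve (followerLaplacian G S0 S1) y δ isSDD_followerLaplacian
      (posDef_followerLaplacian hG hS) hδ
  -- A probability is at most 1, so the solver guarantee itself forces p ≥ 0.
  have hp : 0 ≤ p := nonneg_of_le_prob (hgood 0 1 one_pos)
  have hfail : ∀ (y : Follower S0 S1 → ℝ) (δ : ℝ), 0 < δ →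
      (Solve (followerLaplacian G S0 S1) y δ).toOuterMeasure
        {x | IsGoodSolution G S0 S1 y δ x}ᶜ ≤ ENNReal.ofReal p :=
    fun y δ hδ => toOuterMeasure_compl_le_of_le_prob (hgood y δ hδ)
  have hδ1 := delta1_pos hn hε0
  have hδ2 := delta2_pos hn hε0 hη
  have hδ3 := delta3_pos hn hε0 hε
  set N := Fintype.card (Follower S0 S1) with hN
  have hN0 : (0 : ℝ) < N := Nat.cast_pos.2 (by omega)
  set t := numRows N ε with ht
  rw [sub_sub]
  refine le_prob_of_toOuterMeasure_compl_le (by positivity) ?_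
  -- One summand per stage, in the order of the draws: P, R, h, q, the t rows of X, the t rows of Y,
  -- and 0 for the deterministic return.
  have htotal : ENNReal.ofReal (1 / N + (2 * t + 2) * p) =
      ENNReal.ofReal (1 / (2 * N)) + (ENNReal.ofReal (1 / (2 * N)) + (ENNReal.ofReal p +
        (ENNReal.ofReal p + (t * ENNReal.ofReal p + (t * ENNReal.ofReal p + 0))))) := by
    rw [add_zero, ← ENNReal.ofReal_natCast t, ← ENNReal.ofReal_mul (Nat.cast_nonneg _),
      ← ENNReal.ofReal_add (by positivity) (by positivity),
      ← ENNReal.ofReal_add (by positivity) (by positivity),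
      ← ENNReal.ofReal_add (by positivity) (by positivity),
      ← ENNReal.ofReal_add (by positivity) (by positivity),
      ← ENNReal.ofReal_add (by positivity) (by positivity)]
    congr 1
    field_simp
    ring
  rw [htotal]
  classical
  refine toOuterMeasure_bind_compl_le _ _ {P | IsGoodProjection G S0 S1 ε (incidence o) P} _
    (isGoodProjection_failure_le hε0 hε hF _) fun P hP => ?_
  refine toOuterMeasure_bind_compl_le _ _
    {R | IsGoodProjection G S0 S1 ε (sqrtLeaderMatrix G S0 S1) R} _
    (isGoodProjection_failure_le hε0 hε hF _) fun R hR => ?_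
  refine toOuterMeasure_bind_compl_le _ _ _ _ (hfail _ _ hδ1) fun h hh => ?_
  refine toOuterMeasure_bind_compl_le _ _ _ _ (hfail _ _ hδ2) fun q hq => ?_
  refine toOuterMeasure_bind_compl_le _ _ _ _
    (toOuterMeasure_drawAll_compl_le t _ _ fun i => hfail _ _ hδ3) fun X hX => ?_
  refine toOuterMeasure_bind_compl_le _ _ _ _
    (toOuterMeasure_drawAll_compl_le t _ _ fun i => hfail _ _ hδ3) fun Y hY => ?_
  refine le_of_eq ((PMF.toOuterMeasure_pure_apply _ _).trans (if_neg (not_not.2 fun e => ?_)))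
  obtain ⟨he, hadj, hle⟩ := hQ e e.2
  exact returned_value_accuracy hG hn x0 hε0 hε hη he hadj hle o hP hR hh hq hX hY
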